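/- Let $k$ be a field and $q\in k$, $q\neq 0$. Let $SU_q(2)$ be the $k$-algebra generated by $\alpha,\beta,\gamma,\delta$ with relations $\alpha\beta=q\beta\alpha$, $\alpha\gamma=q\gamma\alpha$, $\alpha\delta=\delta\alpha+(q-q^{-1})\beta\gamma$, $\beta\gamma=\gamma\beta$, $\beta\delta=q\delta\beta$, $\gamma\delta=q\delta\gamma$, $\alpha\delta-q\beta\gamma=1$, with the matrix coproduct $\Delta$. Let $P=SO_q(3)$ be its subalgebra of elements of even degree (generated by the products of two generators), let $A=k[Z,Z^{-1}]$ with $\Delta Z=Z\otimes Z$, and let $\Delta_R:P\to P\otimes A$ be the restriction of $(\mathrm{id}\otimes\pi)\circ\Delta$, where $\pi(\alpha)=Z^{1/2}$, $\pi(\delta)=Z^{-1/2}$, $\pi(\beta)=\pi(\gamma)=0$; so $\alpha,\gamma$ have weight $Z^{1/2}$ and $\beta,\delta$ have weight $Z^{-1/2}$. Let $B=S_q^2\subseteq P$ be the subalgebra generated by $1$, $b_-=\alpha\beta$, $b_+=\gamma\delta$, $b_3=\alpha\delta$. For a Hopf algebra $A$, an algebra $Q$ with an algebra map $\rho:Q\to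 Q\otimes A$, and a subalgebra $C\subseteq Q$, call $Q(C,A)$ a *quantum principal bundle* (with universal differential calculus) if $\rho$ is a right coaction, $C=\{u:\rho(u)=u\otimes1\}$, the map $Q\otimes Q\to Q\otimes A$, $u\otimes v\mapsto(u\otimes 1)\rho(v)$, is surjective, and the kernel of its restriction to $\Gamma_Q=\ker(Q\otimes Q\xrightarrow{\ \cdot\ }Q)$ equals the sub-bimodule $Q\,\Gamma_C\,Q$ generated by $\Gamma_C=\ker(C\otimes C\xrightarrow{\ \cdot\ } C)$. It is *trivial* with trivialization $\Phi:A\to Q$ if moreover $\Phi$ is linear and convolution invertible, with $\Phi(1)=1$ and $\rho\circ\Phi=(\Phi\otimes\mathrm{id})\circ\Delta$. Let $P_0$ (resp. $P_1$) be the localization of $P$ in which the products of two of $\alpha,\delta$ (resp. of two of $\beta,\gamma$) are made invertible, so that it contains $\delta^{-1}\alpha:=(\alpha\delta)^{-1}\alpha^2$ and $\alpha^{-1}\delta:=(\delta\alpha)^{-1}\delta^2$ (resp. $\gamma\beta^{-1}:=(\gamma\beta)(\beta^2)^{-1}$ and $\beta\gamma^{-1}:=(\beta\gamma)(\gamma^2)^{-1}$),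 and let $P_{01}$ be the double localization, in which both sets of products are made invertible, all three with the coaction extended from $P$. Let $B_0=S_q^2[b_3^{-1}]\subseteq P_0$, $B_1=S_q^2[(1-b_3)^{-1}]\subseteq P_1$ and $B_{01}=S_q^2[b_3^{-1},(1-b_3)^{-1}]\subseteq P_{01}$ be the subalgebras generated by the image of $S_q^2$ and the inverses shown. Then: 1. $P(B,A)$ is a quantum principal bundle. 2. $b_3$ is invertible in $P_0$ and $1-b_3$ is invertible in $P_1$, and $P_0(B_0,A)$ and $P_1(B_1,A)$ are trivial quantum principal bundles with trivializations the algebra maps $\Phi_0,\Phi_1$ given by $\Phi_0(Z)=\delta^{-1}\alpha$, $\Phi_0(Z^{-1})=\alpha^{-1}\delta$, $\Phi_1(Z)=-\gamma\beta^{-1}$, $\Phi_1(Z^{-1})=-\beta\gamma^{-1}$. 3. The restriction maps $P\to P_i\to P_{01}$ are injective algebra maps intertwining the coactions, and the two composites $P\to P_{01}$ agree. If $u_0\in P_0$ and $u_1\in P_1$ have the same image in $P_{01}$, then they are the restrictions of a unique $u\in P$; and likewise for $B,B_0,B_1$ in place of $P,P_0,P_1$. 4. $P_{01}(B_{01},A)$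 is a trivial quantum principal bundle, for each of the restricted trivializations $\Phi_0$ and $\Phi_1$, and these are related by a gauge transformation: there is a convolution invertible linear map $\gamma_{01}:A\to B_{01}$ with $\gamma_{01}(1)=1$ and $\Phi_0=\gamma_{01}*\Phi_1$ as maps $A\to P_{01}$, namely $\gamma_{01}(Z^n)=\Phi_0(Z^n)\,\Phi_1(Z^{-n})$ for $n\in\mathbb Z$; in particular $\gamma_{01}(Z)=\Phi_0(Z)\Phi_1(Z)^{-1}\in B_{01}$. -/

import Mathlib

open scoped TensorProduct LaurentPolynomial
open LaurentPolynomial (T)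

noncomputable section

namespace QuantumBundle

/-! ## Quantum principal bundles with the universal differential calculus -/

section General

variable {k P A : Type*} [Field k] [Ring P] [Algebra k P] [Ring A] [HopfAlgebra k A]

/-- `(P, ρ)` is a right `A`-comodule algebra. The coaction is an algebra map by its type. -/
structure IsComoduleAlgebra (ρ : P →ₐ[k] P ⊗[k] A) : Prop where
  coassoc : (TensorProduct.assoc k P A A).toLinearMap ∘ₗ
      ρ.toLinearMap.rTensor A ∘ₗ ρ.toLinearMap =
    (Coalgebra.comul (R := k) (A := A)).lTensor P ∘ₗ ρ.toLinearMap
  counit : (TensorProduct.rid k P).toLinearMap ∘ₗ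
      (Coalgebra.counit (R := k) (A := A)).lTensor P ∘ₗ ρ.toLinearMap = LinearMap.id

/-- The invariant subalgebra `{u | ρ u = u ⊗ 1}`. -/
def coinvariants (ρ : P →ₐ[k] P ⊗[k] A) : Subalgebra k P :=
  AlgHom.equalizer ρ Algebra.TensorProduct.includeLeft

/-- The map `(· ⊗ id) ∘ (id ⊗ ρ) : P ⊗ P → P ⊗ A`, that is, `u ⊗ v ↦ (u ⊗ 1) * ρ v`. -/
def canMap (ρ : P →ₐ[k] P ⊗[k] A) : P ⊗[k] P →ₗ[k] P ⊗[k] A :=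
  (LinearMap.mul' k P).rTensor A ∘ₗ (TensorProduct.assoc k P P A).symm.toLinearMap ∘ₗ
    ρ.toLinearMap.lTensor P

variable (k P) in
/-- The universal one-forms on `P`: the kernel of the product map `P ⊗ P → P`. -/
def oneForms : Submodule k (P ⊗[k] P) := LinearMap.ker (LinearMap.mul' k P)

/-- The horizontal one-forms `P j(Γ_B) P`: the sub-bimodule of `P ⊗ P` generated by the image of
the universal one-forms on the subalgebra `B`. -/
def horizontalForms (B : Subalgebra k P) : Submodule k (P ⊗[k] P) :=
  Submodule.span k {w | ∃ (u v : P), ∃ x ∈ oneForms k B,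
    w = TensorProduct.map (LinearMap.mulLeft k u) (LinearMap.mulRight k v)
      (TensorProduct.map B.val.toLinearMap B.val.toLinearMap x)}

/-- The map generating the fundamental vector fields, `Γ_P → P ⊗ A`: the restriction of `canMap`
to the universal one-forms. -/
def tilde (ρ : P →ₐ[k] P ⊗[k] A) : oneForms k P →ₗ[k] P ⊗[k] A :=
  (canMap ρ).domRestrict (oneForms k P)

/-- `P(B, A)` is a quantum principal bundle with the universal differential calculus. -/
structure IsQuantumPrincipalBundle (ρ : P →ₐ[k] P ⊗[k] A) (B : Subalgebra k P) : Prop where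
  comoduleAlgebra : IsComoduleAlgebra ρ
  base : B = coinvariants ρ
  free : Function.Surjective (canMap ρ)
  exact : (LinearMap.ker (tilde ρ)).map (oneForms k P).subtype = horizontalForms B

/-- `Φ : A → P` is a trivialization: unital, an intertwiner for the coaction `ρ` and the right
regular coaction of `A` on itself, and invertible for the convolution product. -/
structure IsTrivialization (ρ : P →ₐ[k] P ⊗[k] A) (Φ : A →ₗ[k] P) : Prop where
  map_one : Φ 1 = 1
  intertwiner : ρ.toLinearMap ∘ₗ Φ = Φ.rTensor A ∘ₗ Coalgebra.comul (R := k) (A := A)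
  convInvertible : IsUnit (WithConv.toConv Φ)

/-- `P(B, A, Φ)` is a trivial quantum principal bundle with trivialization `Φ`. -/
structure IsTrivialBundle (ρ : P →ₐ[k] P ⊗[k] A) (B : Subalgebra k P) (Φ : A →ₗ[k] P) :
    Prop where
  bundle : IsQuantumPrincipalBundle ρ B
  trivialization : IsTrivialization ρ Φ

/-- The algebra map `f : P → Q` intertwines the coactions `ρ` and `σ`. -/
def Intertwines {Q : Type*} [Ring Q] [Algebra k Q]
    (ρ : P →ₐ[k] P ⊗[k] A) (σ : Q →ₐ[k] Q ⊗[k] A) (f : P →ₐ[k] Q) : Prop :=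
  σ.comp f = (Algebra.TensorProduct.map f (AlgHom.id k A)).comp ρ

end General

/-! ## Localization of a (noncommutative) algebra at a set of elements -/

section Localization

variable (k : Type*) [Field k] {R : Type*} [Ring R] [Algebra k R] (S : Set R)

/-- The relations of the localization: the copy of `R` sits in it by an algebra map, and the
second family of generators consists of two-sided inverses of the elements of `S`. -/
inductive LocRel : FreeAlgebra k (R ⊕ S) → FreeAlgebra k (R ⊕ S) → Prop
  | add (x y : R) : LocRel (FreeAlgebra.ι k (Sum.inl (x + y)))
      (FreeAlgebra.ι k (Sum.inl x) + FreeAlgebra.ι k (Sum.inl y))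
  | mul (x y : R) : LocRel (FreeAlgebra.ι k (Sum.inl (x * y)))
      (FreeAlgebra.ι k (Sum.inl x) * FreeAlgebra.ι k (Sum.inl y))
  | scalar (c : k) : LocRel (FreeAlgebra.ι k (Sum.inl (algebraMap k R c)))
      (algebraMap k (FreeAlgebra k (R ⊕ S)) c)
  | mul_inv (s : S) : LocRel
      (FreeAlgebra.ι k (Sum.inl (s : R)) * FreeAlgebra.ι k (Sum.inr s)) 1
  | inv_mul (s : S) : LocRel
      (FreeAlgebra.ι k (Sum.inr s) * FreeAlgebra.ι k (Sum.inl (s : R))) 1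

/-- The localization of the `k`-algebra `R` at the set `S`: the universal `k`-algebra under `R`
in which the elements of `S` are invertible. -/
def Loc : Type _ := RingQuot (LocRel k S)

namespace Loc

instance : Ring (Loc k S) := inferInstanceAs (Ring (RingQuot (LocRel k S)))

instance : Algebra k (Loc k S) := inferInstanceAs (Algebra k (RingQuot (LocRel k S)))

/-- The quotient map from the free algebra. -/
def mk : FreeAlgebra k (R ⊕ S) →ₐ[k] Loc k S := RingQuot.mkAlgHom k (LocRel k S)

variable {k S} in
theorem mk_rel {x y : FreeAlgebra k (R ⊕ S)} (h : LocRel k S x y) : mk k S x = mk k S y :=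
  RingQuot.mkAlgHom_rel k h

/-- The canonical map `R → R[S⁻¹]`. -/
def of : R →ₐ[k] Loc k S where
  toFun x := mk k S (FreeAlgebra.ι k (Sum.inl x))
  map_one' := by
    have h := mk_rel (LocRel.scalar (k := k) (S := S) 1)
    simpa using h
  map_mul' x y := by simpa using mk_rel (LocRel.mul (k := k) (S := S) x y)
  map_zero' := by
    have h := mk_rel (LocRel.scalar (k := k) (S := S) 0)
    simpa using h
  map_add' x y := by simpa using mk_rel (LocRel.add (k := k) (S := S) x y)
  commutes' c := by simpa using mk_rel (LocRel.scalar (k := k) (S := S) c)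

/-- The inverse of an element of `S`. -/
def inv (s : S) : Loc k S := mk k S (FreeAlgebra.ι k (Sum.inr s))

theorem of_mul_inv (s : S) : of k S (s : R) * inv k S s = 1 := by
  simpa [of, inv] using mk_rel (LocRel.mul_inv (k := k) (S := S) s)

theorem inv_mul_of (s : S) : inv k S s * of k S (s : R) = 1 := by
  simpa [of, inv] using mk_rel (LocRel.inv_mul (k := k) (S := S) s)

/-- An element of `S`, as a unit of the localization. -/
def unit (s : S) : (Loc k S)ˣ := ⟨of k S s, inv k S s, of_mul_inv k S s, inv_mul_of k S s⟩

variable {k S} {Q : Type*} [Ring Q] [Algebra k Q]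

/-- The universal property of the localization. -/
def lift (f : R →ₐ[k] Q) (hf : ∀ s ∈ S, IsUnit (f s)) : Loc k S →ₐ[k] Q :=
  RingQuot.liftAlgHom k ⟨FreeAlgebra.lift k
      (Sum.elim f fun s => (((hf s s.2).unit⁻¹ : Qˣ) : Q)), by
    intro x y h
    induction h with
    | add x y => simp
    | mul x y => simp
    | scalar c => simp
    | mul_inv s => simp
    | inv_mul s => simp⟩

theorem lift_of (f : R →ₐ[k] Q) (hf : ∀ s ∈ S, IsUnit (f s)) (x : R) :
    lift f hf (of k S x) = f x :=
  (RingQuot.liftAlgHom_mkAlgHom_apply k _ _ (FreeAlgebra.ι k (Sum.inl x))).trans (by simp)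

end Loc

/-- The restriction map `R[S⁻¹] → R[S'⁻¹]` for `S ⊆ S'`. -/
def Loc.res {S S' : Set R} (h : S ⊆ S') : Loc k S →ₐ[k] Loc k S' :=
  Loc.lift (Loc.of k S') fun s hs => (Loc.unit k S' ⟨s, h hs⟩).isUnit

/-- The extension to `R[S⁻¹]` of a coaction of `k[Z, Z⁻¹]` on `R` for which the elements of `S` are
homogeneous. -/
def Loc.coaction (ρ : R →ₐ[k] R ⊗[k] k[T;T⁻¹]) (hS : ∀ s ∈ S, ∃ n : ℤ, ρ s = s ⊗ₜ T n) :
    Loc k S →ₐ[k] Loc k S ⊗[k] k[T;T⁻¹] :=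
  Loc.lift ((Algebra.TensorProduct.map (Loc.of k S) (AlgHom.id k _)).comp ρ) <| by
    intro s hs
    obtain ⟨n, hn⟩ := hS s hs
    refine ⟨⟨Loc.of k S s ⊗ₜ T n, Loc.inv k S ⟨s, hs⟩ ⊗ₜ T (-n), ?_, ?_⟩, by simp [hn]⟩
    · have h := Loc.of_mul_inv k S ⟨s, hs⟩
      simp only at h
      rw [Algebra.TensorProduct.tmul_mul_tmul, h, ← LaurentPolynomial.T_add, add_neg_cancel,
        LaurentPolynomial.T_zero, Algebra.TensorProduct.one_def]
    · have h := Loc.inv_mul_of k S ⟨s, hs⟩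
      simp only at h
      rw [Algebra.TensorProduct.tmul_mul_tmul, h, ← LaurentPolynomial.T_add, neg_add_cancel,
        LaurentPolynomial.T_zero, Algebra.TensorProduct.one_def]

variable {k} in
/-- For an algebra map `f : R → Q`, the subalgebra `B[D⁻¹]` of `Q` generated by the image of the
subalgebra `B` of `R` and by the inverses in `Q` of the elements of `D`. -/
def adjoinInverses {Q : Type*} [Ring Q] [Algebra k Q] (f : R →ₐ[k] Q) (B : Subalgebra k R)
    (D : Set R) : Subalgebra k Q :=
  Algebra.adjoin k (f '' B ∪ {x | ∃ d ∈ D, f d * x = 1 ∧ x * f d = 1})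

end Localization

variable {k : Type*} [Field k]

/-! ## The quantum group `SU_q(2)` -/

/-- The entries of the generating matrix `(α, β; γ, δ)`. -/
inductive Gen
  | α | β | γ | δ

/-- The relations of `SU_q(2)`. -/
inductive SUq2Rel (q : k) : FreeAlgebra k Gen → FreeAlgebra k Gen → Prop
  | ab : SUq2Rel q (.ι k .α * .ι k .β) (q • (.ι k .β * .ι k .α))
  | ac : SUq2Rel q (.ι k .α * .ι k .γ) (q • (.ι k .γ * .ι k .α))
  | ad : SUq2Rel q (.ι k .α * .ι k .δ)
      (.ι k .δ * .ι k .α + (q - q⁻¹) • (.ι k .β * .ι k .γ))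
  | bc : SUq2Rel q (.ι k .β * .ι k .γ) (.ι k .γ * .ι k .β)
  | bd : SUq2Rel q (.ι k .β * .ι k .δ) (q • (.ι k .δ * .ι k .β))
  | cd : SUq2Rel q (.ι k .γ * .ι k .δ) (q • (.ι k .δ * .ι k .γ))
  | det : SUq2Rel q (.ι k .α * .ι k .δ - q • (.ι k .β * .ι k .γ)) 1

/-- The algebra `SU_q(2)`, generated by `α, β, γ, δ`. -/
def SUq2 (q : k) : Type _ := RingQuot (SUq2Rel q)

namespace SUq2

instance (q : k) : Ring (SUq2 q) := inferInstanceAs (Ring (RingQuot (SUq2Rel q)))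

instance (q : k) : Algebra k (SUq2 q) := inferInstanceAs (Algebra k (RingQuot (SUq2Rel q)))

/-- The quotient map from the free algebra. -/
def mk (q : k) : FreeAlgebra k Gen →ₐ[k] SUq2 q := RingQuot.mkAlgHom k (SUq2Rel q)

/-- The generators of `SU_q(2)`. -/
def gen (q : k) (x : Gen) : SUq2 q := mk q (.ι k x)

section relations

variable (q : k)

theorem mk_rel {x y : FreeAlgebra k Gen} (h : SUq2Rel q x y) : mk q x = mk q y :=
  RingQuot.mkAlgHom_rel k h

theorem rel_ab : gen q .α * gen q .β = q • (gen q .β * gen q .α) := by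
  have h := mk_rel q .ab
  simpa only [gen, map_mul, map_smul] using h

theorem rel_ac : gen q .α * gen q .γ = q • (gen q .γ * gen q .α) := by
  have h := mk_rel q .ac
  simpa only [gen, map_mul, map_smul] using h

theorem rel_ad : gen q .α * gen q .δ =
    gen q .δ * gen q .α + (q - q⁻¹) • (gen q .β * gen q .γ) := by
  have h := mk_rel q .ad
  simpa only [gen, map_mul, map_smul, map_add] using h

theorem rel_bc : gen q .β * gen q .γ = gen q .γ * gen q .β := by
  have h := mk_rel q .bc
  simpa only [gen, map_mul, map_smul] using h

theorem rel_bd : gen q .β * gen q .δ = q • (gen q .δ * gen q .β) := by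
  have h := mk_rel q .bd
  simpa only [gen, map_mul, map_smul] using h

theorem rel_cd : gen q .γ * gen q .δ = q • (gen q .δ * gen q .γ) := by
  have h := mk_rel q .cd
  simpa only [gen, map_mul, map_smul] using h

theorem rel_det : gen q .α * gen q .δ - q • (gen q .β * gen q .γ) = 1 := by
  have h := mk_rel q .det
  simpa only [gen, map_mul, map_smul, map_sub, map_one] using h

end relations

/-- A matrix `(a, b; c, d)` over an algebra that obeys the relations defines an algebra map. -/
def lift {Q : Type*} [Ring Q] [Algebra k Q] (q : k) (f : Gen → Q)
    (ab : f .α * f .β = q • (f .β * f .α)) (ac : f .α * f .γ = q • (f .γ * f .α))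
    (ad : f .α * f .δ = f .δ * f .α + (q - q⁻¹) • (f .β * f .γ))
    (bc : f .β * f .γ = f .γ * f .β)
    (bd : f .β * f .δ = q • (f .δ * f .β)) (cd : f .γ * f .δ = q • (f .δ * f .γ))
    (det : f .α * f .δ - q • (f .β * f .γ) = 1) : SUq2 q →ₐ[k] Q :=
  RingQuot.liftAlgHom k ⟨FreeAlgebra.lift k f, by
    intro x y h
    induction h with
    | ab => simpa using ab
    | ac => simpa using ac
    | ad => simpa using ad
    | bc => simpa using bc
    | bd => simpa using bd
    | cd => simpa using cd
    | det => simpa using det⟩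

/-- The matrix comultiplication on generators. -/
def comulGen (q : k) : Gen → SUq2 q ⊗[k] SUq2 q
  | .α => gen q .α ⊗ₜ gen q .α + gen q .β ⊗ₜ gen q .γ
  | .β => gen q .α ⊗ₜ gen q .β + gen q .β ⊗ₜ gen q .δ
  | .γ => gen q .γ ⊗ₜ gen q .α + gen q .δ ⊗ₜ gen q .γ
  | .δ => gen q .γ ⊗ₜ gen q .β + gen q .δ ⊗ₜ gen q .δ

theorem gen_ba {q : k} (hq : q ≠ 0) : gen q .β * gen q .α = q⁻¹ • (gen q .α * gen q .β) := by
  rw [rel_ab, smul_smul, inv_mul_cancel₀ hq, one_smul]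

theorem gen_ca {q : k} (hq : q ≠ 0) : gen q .γ * gen q .α = q⁻¹ • (gen q .α * gen q .γ) := by
  rw [rel_ac, smul_smul, inv_mul_cancel₀ hq, one_smul]

theorem gen_db {q : k} (hq : q ≠ 0) : gen q .δ * gen q .β = q⁻¹ • (gen q .β * gen q .δ) := by
  rw [rel_bd, smul_smul, inv_mul_cancel₀ hq, one_smul]

theorem gen_dc {q : k} (hq : q ≠ 0) : gen q .δ * gen q .γ = q⁻¹ • (gen q .γ * gen q .δ) := by
  rw [rel_cd, smul_smul, inv_mul_cancel₀ hq, one_smul]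

theorem gen_ad (q : k) : gen q .α * gen q .δ = 1 + q • (gen q .β * gen q .γ) := by
  rw [← rel_det q]; abel

theorem gen_da (q : k) : gen q .δ * gen q .α = 1 + q⁻¹ • (gen q .β * gen q .γ) := by
  have h := rel_ad q
  rw [gen_ad q] at h
  have h2 : gen q .δ * gen q .α =
      1 + q • (gen q .β * gen q .γ) - (q - q⁻¹) • (gen q .β * gen q .γ) := by
    rw [h]; abel
  rw [h2]; module

/-- The comultiplication of `SU_q(2)`. -/
def comul (q : k) (hq : q ≠ 0) : SUq2 q →ₐ[k] SUq2 q ⊗[k] SUq2 q := by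
  refine lift q (comulGen q) ?_ ?_ ?_ ?_ ?_ ?_ ?_ <;>
  simp only [comulGen, mul_add, add_mul, Algebra.TensorProduct.tmul_mul_tmul,
    gen_ba hq, gen_ca hq, gen_db hq, gen_dc hq, gen_ad, gen_da, ← rel_bc,
    TensorProduct.tmul_add, TensorProduct.add_tmul, TensorProduct.tmul_smul,
    ← TensorProduct.smul_tmul', Algebra.TensorProduct.one_def] <;>
  match_scalars <;> field_simp <;> ring

/-- The algebra map `π : SU_q(2) → k[Z^{1/2}, Z^{-1/2}]` to the diagonal circle, on generators.
Here the variable `T 1` stands for `Z^{1/2}`. -/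
def projGen (k : Type*) [Field k] : Gen → k[T;T⁻¹]
  | .α => T 1
  | .β => 0
  | .γ => 0
  | .δ => T (-1)

/-- The projection `π` with `π(α) = Z^{1/2}`, `π(δ) = Z^{-1/2}`, `π(β) = π(γ) = 0`. -/
def proj (q : k) : SUq2 q →ₐ[k] k[T;T⁻¹] := by
  refine lift q (projGen k) ?_ ?_ ?_ ?_ ?_ ?_ ?_ <;>
  simp only [projGen, ← LaurentPolynomial.T_add, mul_zero, zero_mul, smul_zero, add_zero,
    sub_zero, add_neg_cancel, neg_add_cancel, LaurentPolynomial.T_zero]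

/-- The coaction `(id ⊗ π) ∘ Δ` of `k[Z^{1/2}, Z^{-1/2}]` on `SU_q(2)`. -/
def coaction (q : k) (hq : q ≠ 0) : SUq2 q →ₐ[k] SUq2 q ⊗[k] k[T;T⁻¹] :=
  (Algebra.TensorProduct.map (AlgHom.id k _) (proj q)).comp (comul q hq)

theorem lift_gen {Q : Type*} [Ring Q] [Algebra k Q] (q : k) (f : Gen → Q)
    (h₁ h₂ h₃ h₄ h₅ h₆ h₇) (x : Gen) : lift q f h₁ h₂ h₃ h₄ h₅ h₆ h₇ (gen q x) = f x :=
  (RingQuot.liftAlgHom_mkAlgHom_apply k _ _ (FreeAlgebra.ι k x)).trans (by simp)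

/-- The weight (in powers of `Z^{1/2}`) of a generator under the coaction. -/
def weight : Gen → ℤ
  | .α => 1
  | .β => -1
  | .γ => 1
  | .δ => -1

/-- `α, γ ↦ α ⊗ Z^{1/2}, γ ⊗ Z^{1/2}` and `β, δ ↦ β ⊗ Z^{-1/2}, δ ⊗ Z^{-1/2}`. -/
theorem coaction_gen (q : k) (hq : q ≠ 0) (x : Gen) :
    coaction q hq (gen q x) = gen q x ⊗ₜ T (weight x) := by
  cases x <;> simp [coaction, comul, proj, lift_gen, comulGen, projGen, weight]

end SUq2

/-! ## The quantum group `SO_q(3)` and the coaction of `U(1)` -/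

/-- `SO_q(3)`: the subalgebra of the elements of even degree in `SU_q(2)`. -/
def SOq3 (q : k) : Subalgebra k (SUq2 q) :=
  Algebra.adjoin k {u | ∃ x y : Gen, u = SUq2.gen q x * SUq2.gen q y}

namespace SOq3

/-- The product of two generators of `SU_q(2)`, as an element of `SO_q(3)`. -/
def prod (q : k) (x y : Gen) : SOq3 q :=
  ⟨SUq2.gen q x * SUq2.gen q y, Algebra.subset_adjoin ⟨x, y, rfl⟩⟩

/-- The inclusion of Hopf algebras `k[Z, Z⁻¹] → k[Z^{1/2}, Z^{-1/2}]`. -/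
def doubling (k : Type*) [Field k] : k[T;T⁻¹] →ₐ[k] k[T;T⁻¹] :=
  AddMonoidAlgebra.mapDomainAlgHom k k (AddMonoidHom.mulLeft (2 : ℤ))

theorem doubling_T (n : ℤ) : doubling k (T n) = T (2 * n) := by
  simp only [doubling, T, AddMonoidAlgebra.mapDomainAlgHom_apply, AddMonoidAlgebra.mapDomain_single]
  rfl

theorem doubling_injective : Function.Injective (doubling k) :=
  AddMonoidAlgebra.mapDomain_injective fun a b h => by simpa using h

/-- The inclusion `SO_q(3) ⊗ k[Z, Z⁻¹] → SU_q(2) ⊗ k[Z^{1/2}, Z^{-1/2}]`. -/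
def incl (q : k) : SOq3 q ⊗[k] k[T;T⁻¹] →ₐ[k] SUq2 q ⊗[k] k[T;T⁻¹] :=
  Algebra.TensorProduct.map (SOq3 q).val (doubling k)

theorem incl_injective (q : k) : Function.Injective (incl q) := by
  have h := TensorProduct.map_injective_of_flat_flat
    (SOq3 q).val.toLinearMap (doubling k).toLinearMap Subtype.val_injective doubling_injective
  exact h

theorem coaction_prod (q : k) (hq : q ≠ 0) (x y : Gen) (n : ℤ)
    (hn : SUq2.weight x + SUq2.weight y = 2 * n) :
    SUq2.coaction q hq (prod q x y : SOq3 q) = incl q (prod q x y ⊗ₜ T n) := by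
  simp only [prod, incl, map_mul, SUq2.coaction_gen, Algebra.TensorProduct.tmul_mul_tmul,
    Algebra.TensorProduct.map_tmul, doubling_T, ← hn, LaurentPolynomial.T_add, Subalgebra.coe_val]

theorem coaction_mem (q : k) (hq : q ≠ 0) (u : SOq3 q) :
    SUq2.coaction q hq u ∈ (incl q).range := by
  have h : SOq3 q ≤ (incl q).range.comap (SUq2.coaction q hq) := by
    refine Algebra.adjoin_le ?_
    rintro _ ⟨x, y, rfl⟩
    obtain ⟨n, hn⟩ : ∃ n, SUq2.weight x + SUq2.weight y = 2 * n := by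
      cases x <;> cases y <;>
      first | exact ⟨0, rfl⟩ | exact ⟨1, rfl⟩ | exact ⟨-1, rfl⟩
    exact ⟨_, (coaction_prod q hq x y n hn).symm⟩
  exact h u.2

/-- The coaction `Δ_R` of `k[Z, Z⁻¹]` on `SO_q(3)`: the restriction of `(id ⊗ π) ∘ Δ`. -/
def coaction (q : k) (hq : q ≠ 0) : SOq3 q →ₐ[k] SOq3 q ⊗[k] k[T;T⁻¹] :=
  (AlgEquiv.ofInjective (incl q) (incl_injective q)).symm.toAlgHom.comp
    (((SUq2.coaction q hq).comp (SOq3 q).val).codRestrict (incl q).range (coaction_mem q hq))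

/-- `Δ_R` is the restriction of the coaction on `SU_q(2)`. -/
theorem incl_coaction (q : k) (hq : q ≠ 0) (u : SOq3 q) :
    incl q (coaction q hq u) = SUq2.coaction q hq u := by
  have h := (AlgEquiv.ofInjective (incl q) (incl_injective q)).apply_symm_apply
    (((SUq2.coaction q hq).comp (SOq3 q).val).codRestrict (incl q).range (coaction_mem q hq) u)
  exact congrArg Subtype.val h

theorem coaction_apply_prod (q : k) (hq : q ≠ 0) (x y : Gen) (n : ℤ)
    (hn : SUq2.weight x + SUq2.weight y = 2 * n) :
    coaction q hq (prod q x y) = prod q x y ⊗ₜ T n :=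
  incl_injective q (by rw [incl_coaction, coaction_prod q hq x y n hn])

end SOq3

/-! ## The quantum sphere and the two charts -/

variable (q : k)

/-- The generator `b_- = αβ`. -/
def bMinus : SOq3 q := SOq3.prod q .α .β

/-- The generator `b_+ = γδ`. -/
def bPlus : SOq3 q := SOq3.prod q .γ .δ

/-- The generator `b_3 = αδ`. -/
def b3 : SOq3 q := SOq3.prod q .α .δ

/-- The quantum sphere `S_q^2`, the subalgebra of `SO_q(3)` generated by `1, b_-, b_+, b_3`. -/
def sphere : Subalgebra k (SOq3 q) := Algebra.adjoin k {bMinus q, bPlus q, b3 q}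

/-- The elements `α², αδ, δα, δ²` of `SO_q(3)`. -/
def S₀ : Set (SOq3 q) :=
  {SOq3.prod q .α .α, SOq3.prod q .α .δ, SOq3.prod q .δ .α, SOq3.prod q .δ .δ}

/-- The elements `β², βγ, γβ, γ²` of `SO_q(3)`. -/
def S₁ : Set (SOq3 q) :=
  {SOq3.prod q .β .β, SOq3.prod q .β .γ, SOq3.prod q .γ .β, SOq3.prod q .γ .γ}

/-- `P_0`: the localization of `SO_q(3)` in which `α` and `δ` are inverted, that is, in which the
products of degree two in `α, δ` are invertible. -/
abbrev P₀ := Loc k (S₀ q)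

/-- `P_1`: the localization of `SO_q(3)` in which `β` and `γ` are inverted. -/
abbrev P₁ := Loc k (S₁ q)

/-- `P_01`: the double localization. -/
abbrev P₀₁ := Loc k (S₀ q ∪ S₁ q)

/-- The localization map `SO_q(3) → P_0`. -/
abbrev of₀ : SOq3 q →ₐ[k] P₀ q := Loc.of k (S₀ q)

/-- The localization map `SO_q(3) → P_1`. -/
abbrev of₁ : SOq3 q →ₐ[k] P₁ q := Loc.of k (S₁ q)

/-- The localization map `SO_q(3) → P_01`. -/
abbrev of₀₁ : SOq3 q →ₐ[k] P₀₁ q := Loc.of k (S₀ q ∪ S₁ q)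

/-- The restriction map `P_0 → P_01`. -/
abbrev res₀ : P₀ q →ₐ[k] P₀₁ q := Loc.res k Set.subset_union_left

/-- The restriction map `P_1 → P_01`. -/
abbrev res₁ : P₁ q →ₐ[k] P₀₁ q := Loc.res k Set.subset_union_right

/-- `B_0 = S_q^2[b_3⁻¹]` inside `P_0`. -/
def B₀ : Subalgebra k (P₀ q) := adjoinInverses (of₀ q) (sphere q) {b3 q}

/-- `B_1 = S_q^2[(1 - b_3)⁻¹]` inside `P_1`. -/
def B₁ : Subalgebra k (P₁ q) := adjoinInverses (of₁ q) (sphere q) {1 - b3 q}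

/-- `B_01 = S_q^2[b_3⁻¹, (1 - b_3)⁻¹]` inside `P_01`. -/
def B₀₁ : Subalgebra k (P₀₁ q) := adjoinInverses (of₀₁ q) (sphere q) {b3 q, 1 - b3 q}

variable {q}

theorem homogeneous₀ (hq : q ≠ 0) (s : SOq3 q) (hs : s ∈ S₀ q) :
    ∃ n : ℤ, SOq3.coaction q hq s = s ⊗ₜ T n := by
  rcases hs with rfl | rfl | rfl | rfl
  · exact ⟨1, SOq3.coaction_apply_prod q hq _ _ 1 rfl⟩
  · exact ⟨0, SOq3.coaction_apply_prod q hq _ _ 0 rfl⟩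
  · exact ⟨0, SOq3.coaction_apply_prod q hq _ _ 0 rfl⟩
  · exact ⟨-1, SOq3.coaction_apply_prod q hq _ _ (-1) rfl⟩

theorem homogeneous₁ (hq : q ≠ 0) (s : SOq3 q) (hs : s ∈ S₁ q) :
    ∃ n : ℤ, SOq3.coaction q hq s = s ⊗ₜ T n := by
  rcases hs with rfl | rfl | rfl | rfl
  · exact ⟨-1, SOq3.coaction_apply_prod q hq _ _ (-1) rfl⟩
  · exact ⟨0, SOq3.coaction_apply_prod q hq _ _ 0 rfl⟩
  · exact ⟨0, SOq3.coaction_apply_prod q hq _ _ 0 rfl⟩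
  · exact ⟨1, SOq3.coaction_apply_prod q hq _ _ 1 rfl⟩

/-- The coaction of `k[Z, Z⁻¹]` on `P_0`. -/
def coaction₀ (hq : q ≠ 0) : P₀ q →ₐ[k] P₀ q ⊗[k] k[T;T⁻¹] :=
  Loc.coaction k (S₀ q) (SOq3.coaction q hq) (homogeneous₀ hq)

/-- The coaction of `k[Z, Z⁻¹]` on `P_1`. -/
def coaction₁ (hq : q ≠ 0) : P₁ q →ₐ[k] P₁ q ⊗[k] k[T;T⁻¹] :=
  Loc.coaction k (S₁ q) (SOq3.coaction q hq) (homogeneous₁ hq)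

/-- The coaction of `k[Z, Z⁻¹]` on `P_01`. -/
def coaction₀₁ (hq : q ≠ 0) : P₀₁ q →ₐ[k] P₀₁ q ⊗[k] k[T;T⁻¹] :=
  Loc.coaction k (S₀ q ∪ S₁ q) (SOq3.coaction q hq) fun s hs =>
    hs.elim (homogeneous₀ hq s) (homogeneous₁ hq s)

/-- The algebra map `k[Z, Z⁻¹] → Q` that sends `Z` to a given unit. -/
def ofUnit {Q : Type*} [Ring Q] [Algebra k Q] (u : Qˣ) : k[T;T⁻¹] →ₐ[k] Q :=
  AddMonoidAlgebra.lift k Q ℤ ((Units.coeHom Q).comp (zpowersHom Qˣ u))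

variable (q)

/-- The unit `α²` of `P_0`. -/
def unitαα : (P₀ q)ˣ := Loc.unit k (S₀ q) ⟨SOq3.prod q .α .α, by simp [S₀]⟩
/-- The unit `αδ` of `P_0`. -/
def unitαδ : (P₀ q)ˣ := Loc.unit k (S₀ q) ⟨SOq3.prod q .α .δ, by simp [S₀]⟩
/-- The unit `δα` of `P_0`. -/
def unitδα : (P₀ q)ˣ := Loc.unit k (S₀ q) ⟨SOq3.prod q .δ .α, by simp [S₀]⟩
/-- The unit `δ²` of `P_0`. -/
def unitδδ : (P₀ q)ˣ := Loc.unit k (S₀ q) ⟨SOq3.prod q .δ .δ, by simp [S₀]⟩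

/-- The unit `β²` of `P_1`. -/
def unitββ : (P₁ q)ˣ := Loc.unit k (S₁ q) ⟨SOq3.prod q .β .β, by simp [S₁]⟩
/-- The unit `βγ` of `P_1`. -/
def unitβγ : (P₁ q)ˣ := Loc.unit k (S₁ q) ⟨SOq3.prod q .β .γ, by simp [S₁]⟩
/-- The unit `γβ` of `P_1`. -/
def unitγβ : (P₁ q)ˣ := Loc.unit k (S₁ q) ⟨SOq3.prod q .γ .β, by simp [S₁]⟩
/-- The unit `γ²` of `P_1`. -/
def unitγγ : (P₁ q)ˣ := Loc.unit k (S₁ q) ⟨SOq3.prod q .γ .γ, by simp [S₁]⟩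

/-- The trivialization `Φ_0` with `Φ_0(Z) = δ⁻¹α`; as `α` and `δ` have odd degree, this
is written `(αδ)⁻¹ α²`. -/
def Φ₀ : k[T;T⁻¹] →ₐ[k] P₀ q := ofUnit ((unitαδ q)⁻¹ * unitαα q)

/-- The trivialization `Φ_1` with `Φ_1(Z) = -γβ⁻¹`; as `β` and `γ` have odd degree, this
is written `-(γβ) (β²)⁻¹`. -/
def Φ₁ : k[T;T⁻¹] →ₐ[k] P₁ q := ofUnit (-(unitγβ q * (unitββ q)⁻¹))

end QuantumBundle

end

open QuantumBundle

open scoped TensorProduct LaurentPolynomial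
open LaurentPolynomial (T)

noncomputable section

namespace QuantumBundle

/-! ### Linear maps out of the Laurent polynomials -/

section Laurent

variable {k M : Type*} [Field k] [AddCommGroup M] [Module k M]

/-! A coaction of `k[Z, Z⁻¹]` is a ℤ-grading, so the bundle conditions become statements about
graded algebras. Suppose `1 ∈ P₋ₙ Pₙ` for all `n`, and write `1 = ∑ aᵢ bᵢ` accordingly. Then `∑ aᵢ ⊗
bᵢ` is a preimage of `1 ⊗ Zⁿ` under the canonical map. For `v ∈ Pₙ` the elements `v aᵢ` have weight
zero, so these preimages also define an inverse of the canonical map modulo horizontal forms. Hence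
a strongly graded algebra is a quantum principal bundle over its part of weight zero
(`isQuantumPrincipalBundle_coinvariants`). The condition need only be checked for `n = ±1` and it
passes along graded algebra maps; for `SO_q(3)` it follows by substituting the quantum determinant
relation into itself (`SOq3.stronglyGraded`).

It remains to identify the parts of weight zero. In `SO_q(3)` they are read off from a spanning set
of ordered monomials (`SOq3.sphere_eq_coinvariants`). In the localizations, `βγ` commutes with every
product of two generators up to a power of `q²`, so suitable polynomials in `βγ` form a commutative
set of Ore denominators, and every element is a right fraction with denominator of weight zero. A
fraction of weight zero then has a numerator in the sphere, and what is left is to invert the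
denominators inside `B_i`. For `1 - b₃ = -qβγ` this is immediate; from `b₃⁻¹` alone one must produce
the inverses of all `1 + q²ʲ⁺¹ βγ`, which `exists_inverse_den` does with the help of `b_±`.

Injectivity of all restriction maps comes from one representation by weighted shifts that is
faithful on `SO_q(3)` and makes the four generators invertible. Since `β` and `γ` act through
independent variables, `q` may be a root of unity. Gluing is Bézout's identity: the denominators of
the two charts are values at `βγ` of coprime polynomials. Finally, a unit of weight one is the same
as a trivialization by an algebra map, and two such units differ by the gauge transformation `Zⁿ ↦
uⁿ v⁻ⁿ`, which has weight zero. -/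

theorem laurent_hom_ext {f g : k[T;T⁻¹] →ₗ[k] M} (h : ∀ n : ℤ, f (T n) = g (T n)) : f = g :=
  AddMonoidAlgebra.lhom_ext' fun n => LinearMap.ext_ring (h n)

/-- The linear map on Laurent polynomials with prescribed values on the powers of the variable. -/
def laurentLift (e : ℤ → M) : k[T;T⁻¹] →ₗ[k] M :=
  (AddMonoidAlgebra.basis ℤ k).constr k e

@[simp]
theorem laurentLift_T (e : ℤ → M) (n : ℤ) : laurentLift (k := k) e (T n) = e n := by
  have h : (T n : k[T;T⁻¹]) = AddMonoidAlgebra.basis ℤ k n := by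
    simp [T, -LaurentPolynomial.single_eq_C_mul_T]
  rw [laurentLift, h, Module.Basis.constr_basis]

end Laurent

/-! ### Strongly graded algebras as quantum principal bundles -/

section Weights

variable {k P Q : Type*} [Field k] [Ring P] [Algebra k P] [Ring Q] [Algebra k Q]

/-- The elements of weight `n` for a coaction of `k[Z, Z⁻¹]`. -/
def weightSpace (ρ : P →ₐ[k] P ⊗[k] k[T;T⁻¹]) (n : ℤ) : Submodule k P :=
  LinearMap.eqLocus ρ.toLinearMap ((TensorProduct.mk k P k[T;T⁻¹]).flip (T n))

variable {ρ : P →ₐ[k] P ⊗[k] k[T;T⁻¹]}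

theorem mem_weightSpace {n : ℤ} {u : P} : u ∈ weightSpace ρ n ↔ ρ u = u ⊗ₜ T n := Iff.rfl

theorem mul_mem_weightSpace {m n : ℤ} {u v : P} (hu : u ∈ weightSpace ρ m)
    (hv : v ∈ weightSpace ρ n) : u * v ∈ weightSpace ρ (m + n) := by
  rw [mem_weightSpace] at *
  rw [map_mul, hu, hv, Algebra.TensorProduct.tmul_mul_tmul, LaurentPolynomial.T_add]

theorem weightSpace_mul_le (m n : ℤ) :
    weightSpace ρ m * weightSpace ρ n ≤ weightSpace ρ (m + n) :=
  Submodule.mul_le.2 fun _ hu _ hv => mul_mem_weightSpace hu hv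

theorem inverse_mem_weightSpace {n : ℤ} {u v : P} (hu : u ∈ weightSpace ρ n) (huv : u * v = 1)
    (hvu : v * u = 1) : v ∈ weightSpace ρ (-n) := by
  rw [mem_weightSpace] at *
  have h1 : (v ⊗ₜ T (-n)) * ρ u = (1 : P ⊗[k] k[T;T⁻¹]) := by
    rw [hu, Algebra.TensorProduct.tmul_mul_tmul, hvu, ← LaurentPolynomial.T_add]
    simp [Algebra.TensorProduct.one_def]
  have h2 : ρ u * ρ v = 1 := by rw [← map_mul, huv, map_one]
  exact (left_inv_eq_right_inv h1 h2).symm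

theorem mem_coinvariants {u : P} : u ∈ coinvariants ρ ↔ ρ u = u ⊗ₜ 1 := Iff.rfl

theorem mem_coinvariants_iff_weightSpace {u : P} :
    u ∈ coinvariants ρ ↔ u ∈ weightSpace ρ 0 := by
  rw [mem_coinvariants, mem_weightSpace, LaurentPolynomial.T_zero]

/-- The homogeneous elements for a coaction of `k[Z, Z⁻¹]`. -/
def homogeneous (ρ : P →ₐ[k] P ⊗[k] k[T;T⁻¹]) : Submonoid P where
  carrier := {u | ∃ n, u ∈ weightSpace ρ n}
  mul_mem' := fun ⟨m, hm⟩ ⟨n, hn⟩ => ⟨m + n, mul_mem_weightSpace hm hn⟩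
  one_mem' := ⟨0, mem_coinvariants_iff_weightSpace.1 (one_mem _)⟩

theorem span_homogeneous_eq_top {s : Set P} (hs : Algebra.adjoin k s = ⊤)
    (h : s ⊆ homogeneous ρ) : Submodule.span k (homogeneous ρ : Set P) = ⊤ := by
  rw [eq_top_iff, ← Algebra.top_toSubmodule, ← hs, Algebra.adjoin_eq_span]
  exact Submodule.span_mono (Submonoid.closure_le.2 h)

theorem isComoduleAlgebra (h : Submodule.span k (homogeneous ρ : Set P) = ⊤) :
    IsComoduleAlgebra ρ where
  coassoc := LinearMap.ext_on h fun u ⟨n, hn⟩ => by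
    rw [mem_weightSpace] at hn
    simp [hn]
  counit := LinearMap.ext_on h fun u ⟨n, hn⟩ => by
    rw [mem_weightSpace] at hn
    simp [hn]

/-- The property `1 ∈ P₋ₙ Pₙ` of a grading, for all `n`. -/
def StronglyGraded (ρ : P →ₐ[k] P ⊗[k] k[T;T⁻¹]) : Prop :=
  ∀ n, (1 : P) ∈ weightSpace ρ (-n) * weightSpace ρ n

/-- Insert `1 ∈ P₋ₘ Pₘ` between the two factors of `P₋ₙ Pₙ`. -/
theorem one_mem_weightSpace_mul_add {m n : ℤ} (hm : (1 : P) ∈ weightSpace ρ (-m) * weightSpace ρ m)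
    (hn : (1 : P) ∈ weightSpace ρ (-n) * weightSpace ρ n) :
    (1 : P) ∈ weightSpace ρ (-(m + n)) * weightSpace ρ (m + n) := by
  have h : (1 : Submodule k P) ≤ weightSpace ρ (-(m + n)) * weightSpace ρ (m + n) :=
    calc (1 : Submodule k P) ≤ weightSpace ρ (-n) * weightSpace ρ n := Submodule.one_le.2 hn
      _ = weightSpace ρ (-n) * 1 * weightSpace ρ n := by rw [mul_one]
      _ ≤ weightSpace ρ (-n) * (weightSpace ρ (-m) * weightSpace ρ m) * weightSpace ρ n := by
          gcongr
          exact Submodule.one_le.2 hm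
      _ = (weightSpace ρ (-n) * weightSpace ρ (-m)) * (weightSpace ρ m * weightSpace ρ n) := by
          simp only [mul_assoc]
      _ ≤ weightSpace ρ (-n + -m) * weightSpace ρ (m + n) := by
          gcongr <;> exact weightSpace_mul_le _ _
      _ = _ := by rw [neg_add_rev]
  exact Submodule.one_le.1 h

theorem stronglyGraded (h₁ : (1 : P) ∈ weightSpace ρ (-1) * weightSpace ρ 1)
    (h₂ : (1 : P) ∈ weightSpace ρ 1 * weightSpace ρ (-1)) : StronglyGraded ρ := by
  have h₀ : (1 : P) ∈ weightSpace ρ (-0) * weightSpace ρ 0 := by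
    have h : (1 : P) ∈ weightSpace ρ 0 := mem_coinvariants_iff_weightSpace.1 (one_mem _)
    simpa using Submodule.mul_mem_mul h h
  intro n
  induction n with
  | zero => exact h₀
  | succ i hi => exact one_mem_weightSpace_mul_add hi h₁
  | pred i hi => exact one_mem_weightSpace_mul_add hi (by simpa using h₂)

theorem Intertwines.map_mem_weightSpace {σ : Q →ₐ[k] Q ⊗[k] k[T;T⁻¹]} {f : P →ₐ[k] Q}
    (hf : Intertwines ρ σ f) {n : ℤ} {u : P} (hu : u ∈ weightSpace ρ n) :
    f u ∈ weightSpace σ n := by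
  rw [mem_weightSpace] at *
  have h := DFunLike.congr_fun hf u
  simpa [hu] using h

/-- Over a field `f ⊗ id` is injective along with `f`, so invariance can be tested after applying
`f`. -/
theorem mem_coinvariants_of_map {σ : Q →ₐ[k] Q ⊗[k] k[T;T⁻¹]} {f : P →ₐ[k] Q}
    (hf : Intertwines ρ σ f) (hinj : Function.Injective f) {u : P} (hu : f u ∈ coinvariants σ) :
    u ∈ coinvariants ρ := by
  have hinj' : Function.Injective (Algebra.TensorProduct.map f (AlgHom.id k k[T;T⁻¹])) :=
    TensorProduct.map_injective_of_flat_flat f.toLinearMap LinearMap.id hinj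
      Function.injective_id
  refine mem_coinvariants.2 (hinj' ?_)
  rw [show Algebra.TensorProduct.map f (AlgHom.id k _) (ρ u) = σ (f u) from
    (DFunLike.congr_fun hf u).symm, mem_coinvariants.1 hu]
  simp

theorem StronglyGraded.of_intertwines {σ : Q →ₐ[k] Q ⊗[k] k[T;T⁻¹]} {f : P →ₐ[k] Q}
    (h : StronglyGraded ρ) (hf : Intertwines ρ σ f) : StronglyGraded σ := fun n => by
  have h1 : f 1 ∈ (weightSpace ρ (-n) * weightSpace ρ n).map f.toLinearMap := ⟨1, h n, rfl⟩
  rw [Submodule.map_mul, map_one] at h1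
  refine (mul_le_mul' ?_ ?_ : _ ≤ weightSpace σ (-n) * weightSpace σ n) h1 <;>
  · rintro _ ⟨u, hu, rfl⟩
    exact hf.map_mem_weightSpace hu

theorem canMap_tmul (u v : P) : canMap ρ (u ⊗ₜ v) = (u ⊗ₜ 1) * ρ v := by
  have h : ∀ w : P ⊗[k] k[T;T⁻¹], (LinearMap.mul' k P).rTensor k[T;T⁻¹]
      ((TensorProduct.assoc k P P k[T;T⁻¹]).symm (u ⊗ₜ w)) = (u ⊗ₜ 1) * w := fun w => by
    induction w with
    | zero => simp
    | add x y hx hy => simp [TensorProduct.tmul_add, mul_add, hx, hy]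
    | tmul x y => simp
  simpa [canMap] using h (ρ v)

theorem canMap_tmul_of_mem {u v : P} {n : ℤ} (hv : v ∈ weightSpace ρ n) :
    canMap ρ (u ⊗ₜ v) = (u * v) ⊗ₜ T n := by
  rw [canMap_tmul, mem_weightSpace.1 hv, Algebra.TensorProduct.tmul_mul_tmul, one_mul]

theorem canMap_bimodule {B : Subalgebra k P} (hB : B ≤ coinvariants ρ) (u v : P) (x : B ⊗[k] B) :
    canMap ρ (TensorProduct.map (LinearMap.mulLeft k u) (LinearMap.mulRight k v)
      (TensorProduct.map B.val.toLinearMap B.val.toLinearMap x)) =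
      ((u * (LinearMap.mul' k B x : B)) ⊗ₜ 1) * ρ v := by
  induction x with
  | zero => simp
  | add x y hx hy => simp [hx, hy, mul_add, TensorProduct.add_tmul, add_mul]
  | tmul b c =>
    have hc := mem_coinvariants.1 (hB c.2)
    simp [canMap_tmul, hc, ← mul_assoc]

theorem mul_bimodule {B : Subalgebra k P} (u v : P) (x : B ⊗[k] B) :
    LinearMap.mul' k P (TensorProduct.map (LinearMap.mulLeft k u) (LinearMap.mulRight k v)
      (TensorProduct.map B.val.toLinearMap B.val.toLinearMap x)) =
      u * (LinearMap.mul' k B x : B) * v := by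
  induction x with
  | zero => simp
  | add x y hx hy => simp [hx, hy, mul_add, add_mul]
  | tmul b c => simp [← mul_assoc]

/-- This is `u (1 ⊗ c - c ⊗ 1) v`: modulo horizontal forms the tensor product is balanced over `B`.
-/
theorem tmul_sub_tmul_mem_horizontalForms {B : Subalgebra k P} {c : P} (hc : c ∈ B) (u v : P) :
    u ⊗ₜ (c * v) - (u * c) ⊗ₜ v ∈ horizontalForms (k := k) B := by
  refine Submodule.subset_span ⟨u, v, 1 ⊗ₜ ⟨c, hc⟩ - ⟨c, hc⟩ ⊗ₜ 1, ?_, ?_⟩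
  · simp [oneForms]
  · simp

/-- With `1 = ∑ aᵢ bᵢ` in `P₋ₙ Pₙ`, take `e = ∑ aᵢ ⊗ bᵢ`. For `v` of weight `n` each `v aᵢ` is
invariant and may be moved across the tensor sign, so `u ⊗ v = ∑ u ⊗ v aᵢ bᵢ` is congruent to `u v
e`. -/
theorem exists_translation (h : StronglyGraded ρ) (n : ℤ) : ∃ e : P ⊗[k] P,
    canMap ρ e = 1 ⊗ₜ T n ∧ ∀ u : P, ∀ v ∈ weightSpace ρ n,
      u ⊗ₜ v - TensorProduct.map (LinearMap.mulLeft k (u * v)) LinearMap.id e ∈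
        horizontalForms (coinvariants ρ) := by
  -- Replacing `1` by an arbitrary `c ∈ P₋ₙ Pₙ` makes the claim additive, so that induction over
  -- sums of products applies.
  suffices H : ∀ c ∈ weightSpace ρ (-n) * weightSpace ρ n, ∃ e : P ⊗[k] P,
      canMap ρ e = c ⊗ₜ T n ∧ ∀ u : P, ∀ v ∈ weightSpace ρ n,
      u ⊗ₜ (v * c) - TensorProduct.map (LinearMap.mulLeft k (u * v)) LinearMap.id e ∈
        horizontalForms (coinvariants ρ) by
    simpa using H 1 (h n)
  intro c hc
  induction hc using Submodule.mul_induction_on' with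
  | mem_mul_mem a ha b hb =>
    refine ⟨a ⊗ₜ b, canMap_tmul_of_mem hb, fun u v hv => ?_⟩
    have hva : v * a ∈ coinvariants ρ := by
      have := mul_mem_weightSpace hv ha
      rwa [add_neg_cancel, ← mem_coinvariants_iff_weightSpace] at this
    simpa [mul_assoc] using tmul_sub_tmul_mem_horizontalForms hva u b
  | add c hc d hd ihc ihd =>
    obtain ⟨e, he, he'⟩ := ihc
    obtain ⟨f, hf, hf'⟩ := ihd
    refine ⟨e + f, by rw [map_add, he, hf, TensorProduct.add_tmul], fun u v hv => ?_⟩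
    have := add_mem (he' u v hv) (hf' u v hv)
    rwa [sub_add_sub_comm, ← TensorProduct.tmul_add, ← mul_add, ← map_add] at this

theorem canMap_mulLeft (u : P) (e : P ⊗[k] P) :
    canMap ρ (TensorProduct.map (LinearMap.mulLeft k u) LinearMap.id e) =
      (u ⊗ₜ 1) * canMap ρ e := by
  induction e with
  | zero => simp
  | add x y hx hy => simp [hx, hy, mul_add]
  | tmul b c => simp [canMap_tmul, ← mul_assoc]

/-- A strongly graded algebra is a quantum principal bundle over its component of weight zero. -/
theorem isQuantumPrincipalBundle_coinvariants
    (hspan : Submodule.span k (homogeneous ρ : Set P) = ⊤) (h : StronglyGraded ρ) :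
    IsQuantumPrincipalBundle ρ (coinvariants ρ) where
  comoduleAlgebra := isComoduleAlgebra hspan
  base := rfl
  free := by
    rw [← LinearMap.range_eq_top, eq_top_iff]
    choose e he _ using exists_translation h
    rintro x -
    induction x with
    | zero => exact zero_mem _
    | add x y hx hy => exact add_mem hx hy
    | tmul u a =>
      have H : (TensorProduct.mk k P k[T;T⁻¹] u) = canMap ρ ∘ₗ
          TensorProduct.map (LinearMap.mulLeft k u) LinearMap.id ∘ₗ laurentLift e :=
        laurent_hom_ext fun n => by simp [canMap_mulLeft, he]
      exact ⟨_, (DFunLike.congr_fun H a).symm⟩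
  exact := by
    refine le_antisymm ?_ ?_
    · choose e _ he using exists_translation h
      -- The section `u ⊗ Zⁿ ↦ u eₙ`; it inverts the canonical map modulo horizontal forms, so the
      -- kernel consists of horizontal forms.
      let s : P ⊗[k] k[T;T⁻¹] →ₗ[k] P ⊗[k] P :=
        TensorProduct.lift ((LinearMap.llcomp k k[T;T⁻¹] (P ⊗[k] P) (P ⊗[k] P)).flip
          (laurentLift e) ∘ₗ (TensorProduct.mapBilinear (RingHom.id k) P P P P).flip LinearMap.id ∘ₗ
            LinearMap.mul k P)
      have hs : ∀ u n, s (u ⊗ₜ T n) =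
          TensorProduct.map (LinearMap.mulLeft k u) LinearMap.id (e n) := fun u n => by
        simp [s, LinearMap.mulLeft]
        rfl
      have H : ∀ x, x - s (canMap ρ x) ∈ horizontalForms (coinvariants ρ) := by
        intro x
        induction x with
        | zero => simp
        | add x y hx hy => simpa [sub_add_sub_comm] using add_mem hx hy
        | tmul u v =>
          have hv : v ∈ Submodule.span k (homogeneous ρ : Set P) := hspan ▸ trivial
          induction hv using Submodule.span_induction with
          | mem v hv =>
            obtain ⟨n, hn⟩ := hv
            rw [canMap_tmul_of_mem hn, hs]
            exact he n u v hn
          | zero => simp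
          | add x y _ _ hx hy =>
            simpa [sub_add_sub_comm, TensorProduct.tmul_add] using add_mem hx hy
          | smul c x _ hx =>
            simpa [smul_sub, TensorProduct.tmul_smul] using Submodule.smul_mem _ c hx
      rintro _ ⟨x, hx, rfl⟩
      have hx' : canMap ρ (x : P ⊗[k] P) = 0 := hx
      simpa [hx'] using H x
    · refine Submodule.span_le.2 ?_
      rintro _ ⟨u, v, x, hx, rfl⟩
      have hx' : LinearMap.mul' k (coinvariants ρ) x = 0 := hx
      refine ⟨⟨_, ?_⟩, ?_, rfl⟩
      · exact (mul_bimodule u v x).trans (by simp [hx'])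
      · exact (canMap_bimodule le_rfl u v x).trans (by simp [hx'])

theorem ofUnit_T (u : Pˣ) (n : ℤ) : ofUnit (k := k) u (T n) = ((u ^ n : Pˣ) : P) := by
  simp [ofUnit, T, -LaurentPolynomial.single_eq_C_mul_T]

theorem zpow_mem_weightSpace {u : Pˣ} (hu : (u : P) ∈ weightSpace ρ 1) (n : ℤ) :
    ((u ^ n : Pˣ) : P) ∈ weightSpace ρ n := by
  have hinv : ((u⁻¹ : Pˣ) : P) ∈ weightSpace ρ (-1) :=
    inverse_mem_weightSpace hu u.mul_inv u.inv_mul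
  induction n with
  | zero => simpa using mem_coinvariants_iff_weightSpace.1 (one_mem _)
  | succ i hi =>
    rw [zpow_add_one, Units.val_mul]
    exact mul_mem_weightSpace hi hu
  | pred i hi =>
    rw [zpow_sub_one, Units.val_mul]
    exact mul_mem_weightSpace hi hinv

/-- The powers of `Z` are group-like, so convolution is the pointwise product on this basis. -/
theorem convMul_apply_T (f g : WithConv (k[T;T⁻¹] →ₗ[k] P)) (n : ℤ) :
    (f * g) (T n) = f (T n) * g (T n) := by
  rw [LinearMap.convMul_apply]
  simp

theorem conv_hom_ext {f g : WithConv (k[T;T⁻¹] →ₗ[k] P)} (h : ∀ n : ℤ, f (T n) = g (T n)) :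
    f = g :=
  WithConv.ofConv_injective (laurent_hom_ext h)

theorem isUnit_toConv {f : k[T;T⁻¹] →ₗ[k] P} (h : ∀ n : ℤ, IsUnit (f (T n))) :
    IsUnit (WithConv.toConv f) := by
  choose v hv using h
  refine ⟨⟨WithConv.toConv f, WithConv.toConv (laurentLift fun n => ((v n)⁻¹ : Pˣ)), ?_, ?_⟩,
    rfl⟩ <;>
  · refine conv_hom_ext fun n => ?_
    rw [convMul_apply_T, LinearMap.convOne_apply]
    simp [← hv]

theorem isTrivialization_ofUnit {u : Pˣ} (hu : (u : P) ∈ weightSpace ρ 1) :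
    IsTrivialization ρ (ofUnit (k := k) u).toLinearMap where
  map_one := map_one (ofUnit (k := k) u)
  intertwiner := laurent_hom_ext fun n => by
    have h := mem_weightSpace.1 (zpow_mem_weightSpace hu n)
    simpa [ofUnit_T] using h
  convInvertible := isUnit_toConv fun n => by simp [ofUnit_T, -Units.val_zpow_eq_zpow_val]

theorem comp_ofUnit (f : P →ₐ[k] Q) (u : Pˣ) :
    f.comp (ofUnit u) = ofUnit (Units.map (f : P →* Q) u) := by
  have h : (f.comp (ofUnit u)).toLinearMap =
      (ofUnit (k := k) (Units.map (f : P →* Q) u)).toLinearMap :=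
    laurent_hom_ext fun n => by
      simp only [AlgHom.toLinearMap_apply, AlgHom.comp_apply, ofUnit_T, ← map_zpow, Units.coe_map]
      rfl
  exact AlgHom.toLinearMap_injective h

/-- Two trivializations by units of weight one differ by a gauge transformation. -/
theorem exists_gauge {u v : Pˣ} (hu : (u : P) ∈ weightSpace ρ 1) (hv : (v : P) ∈ weightSpace ρ 1)
    {B : Subalgebra k P} (hB : B = coinvariants ρ) : ∃ γ : k[T;T⁻¹] →ₗ[k] B,
      γ 1 = 1 ∧ IsUnit (WithConv.toConv γ) ∧
      WithConv.toConv (ofUnit (k := k) u).toLinearMap =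
        WithConv.toConv (B.val.toLinearMap ∘ₗ γ) *
          WithConv.toConv (ofUnit (k := k) v).toLinearMap ∧
      ∀ n : ℤ, (γ (T n) : P) = ofUnit u (T n : k[T;T⁻¹]) * ofUnit v (T (-n) : k[T;T⁻¹]) := by
  have mem : ∀ {u v : Pˣ}, (u : P) ∈ weightSpace ρ 1 → (v : P) ∈ weightSpace ρ 1 → ∀ n : ℤ,
      ((u ^ n : Pˣ) : P) * ((v ^ (-n) : Pˣ) : P) ∈ B := fun hu hv n => by
    have := mul_mem_weightSpace (zpow_mem_weightSpace hu n) (zpow_mem_weightSpace hv (-n))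
    rwa [add_neg_cancel, ← mem_coinvariants_iff_weightSpace, ← hB] at this
  have hγ : ∀ n, (laurentLift (k := k) (fun n => (⟨_, mem hu hv n⟩ : B)) (T n) : P) =
      ((u ^ n : Pˣ) : P) * ((v ^ (-n) : Pˣ) : P) := fun n => by rw [laurentLift_T]
  refine ⟨laurentLift fun n => ⟨_, mem hu hv n⟩, ?_, isUnit_toConv fun n => ?_,
    conv_hom_ext fun n => ?_, fun n => ?_⟩
  · refine Subtype.ext ?_
    rw [← LaurentPolynomial.T_zero, hγ]
    simp
  · rw [laurentLift_T]
    -- The inverse of `uⁿ v⁻ⁿ` is `vⁿ u⁻ⁿ`, which has weight zero for the same reason and so already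
    -- lies in `B`.
    refine ⟨⟨⟨_, mem hu hv n⟩, ⟨_, mem hv hu n⟩, ?_, ?_⟩, rfl⟩ <;>
    · refine Subtype.ext ?_
      simp only [MulMemClass.mk_mul_mk, ← Units.val_mul, zpow_neg, OneMemClass.coe_one]
      simp
  · rw [convMul_apply_T]
    change ofUnit u (T n) =
      ((laurentLift (k := k) (fun n => (⟨_, mem hu hv n⟩ : B)) (T n) : B) : P) * ofUnit v (T n)
    rw [hγ, ofUnit_T, ofUnit_T, ← Units.val_mul, ← Units.val_mul]
    simp
  · rw [hγ, ofUnit_T, ofUnit_T]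

end Weights

/-! ### Noncommutative localization, right fractions and gluing -/

section Localization

variable {k R Q : Type*} [Field k] [Ring R] [Algebra k R] [Ring Q] [Algebra k Q] {S : Set R}

theorem Loc.induction_on {C : Subalgebra k (Loc k S)} (hof : ∀ r, Loc.of k S r ∈ C)
    (hinv : ∀ s, Loc.inv k S s ∈ C) (x : Loc k S) : x ∈ C := by
  obtain ⟨y, rfl⟩ := RingQuot.mkAlgHom_surjective k (LocRel k S) x
  induction y using FreeAlgebra.induction with
  | grade0 r =>
    rw [AlgHom.commutes]
    exact C.algebraMap_mem r
  | grade1 y =>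
    rcases y with r | s
    · exact hof r
    · exact hinv s
  | mul a b ha hb =>
    rw [map_mul]
    exact mul_mem ha hb
  | add a b ha hb =>
    rw [map_add]
    exact add_mem ha hb

/-- Algebra maps preserve two-sided inverses, and these are unique. -/
theorem Loc.algHom_ext {f g : Loc k S →ₐ[k] Q} (h : f.comp (Loc.of k S) = g.comp (Loc.of k S)) :
    f = g := by
  have hof : ∀ r, f (Loc.of k S r) = g (Loc.of k S r) := DFunLike.congr_fun h
  refine AlgHom.ext fun x => Loc.induction_on (C := AlgHom.equalizer f g) hof (fun s => ?_) x
  have h1 : f (Loc.inv k S s) * f (Loc.of k S s) = 1 := by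
    rw [← map_mul, Loc.inv_mul_of, map_one]
  have h2 : f (Loc.of k S s) * g (Loc.inv k S s) = 1 := by
    rw [hof, ← map_mul, Loc.of_mul_inv, map_one]
  exact left_inv_eq_right_inv h1 h2

theorem Loc.isUnit_of {s : R} (hs : s ∈ S) : IsUnit (Loc.of k S s) := (Loc.unit k S ⟨s, hs⟩).isUnit

theorem Loc.res_of {S' : Set R} (h : S ⊆ S') (r : R) :
    Loc.res k h (Loc.of k S r) = Loc.of k S' r := Loc.lift_of _ _ r

theorem Loc.res_comp_of {S' : Set R} (h : S ⊆ S') :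
    (Loc.res k h).comp (Loc.of k S) = Loc.of k S' := AlgHom.ext (Loc.res_of h)

section Coaction

variable {ρ : R →ₐ[k] R ⊗[k] k[T;T⁻¹]} (hS : ∀ s ∈ S, ∃ n : ℤ, ρ s = s ⊗ₜ T n)

theorem Loc.intertwines_of : Intertwines ρ (Loc.coaction k S ρ hS) (Loc.of k S) :=
  AlgHom.ext fun r => Loc.lift_of _ _ r

theorem Loc.intertwines_res {S' : Set R} (hS' : ∀ s ∈ S', ∃ n : ℤ, ρ s = s ⊗ₜ T n) (h : S ⊆ S') :
    Intertwines (Loc.coaction k S ρ hS) (Loc.coaction k S' ρ hS') (Loc.res k h) := by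
  refine Loc.algHom_ext ?_
  rw [AlgHom.comp_assoc, AlgHom.comp_assoc, Loc.res_comp_of,
    show _ = _ from Loc.intertwines_of hS', show _ = _ from Loc.intertwines_of hS,
    ← AlgHom.comp_assoc, ← Algebra.TensorProduct.map_comp, Loc.res_comp_of, AlgHom.id_comp]

/-- The localization is generated by images of homogeneous elements and inverses of such, and the
latter are again homogeneous. -/
theorem Loc.span_homogeneous (h : Submodule.span k (homogeneous ρ : Set R) = ⊤) :
    Submodule.span k (homogeneous (Loc.coaction k S ρ hS) : Set (Loc k S)) = ⊤ := by
  have hof : ∀ {r n}, r ∈ weightSpace ρ n →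
      Loc.of k S r ∈ weightSpace (Loc.coaction k S ρ hS) n :=
    (Loc.intertwines_of hS).map_mem_weightSpace
  have hadj : Algebra.adjoin k (homogeneous (Loc.coaction k S ρ hS) : Set (Loc k S)) = ⊤ := by
    refine eq_top_iff.2 fun x _ => Loc.induction_on (fun r => ?_) (fun s => ?_) x
    · have hr : r ∈ Submodule.span k (homogeneous ρ : Set R) := h ▸ trivial
      refine (Submodule.span_le (p := (Subalgebra.toSubmodule (Algebra.adjoin k
        (homogeneous (Loc.coaction k S ρ hS) : Set (Loc k S)))).comap
          (Loc.of k S).toLinearMap)).2 ?_ hr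
      rintro r ⟨n, hn⟩
      exact Algebra.subset_adjoin ⟨n, hof hn⟩
    · obtain ⟨n, hn⟩ := hS s s.2
      exact Algebra.subset_adjoin ⟨-n, inverse_mem_weightSpace (hof hn) (Loc.of_mul_inv k S s)
        (Loc.inv_mul_of k S s)⟩
  exact span_homogeneous_eq_top hadj subset_rfl

theorem adjoinInverses_le_coinvariants {σ : Q →ₐ[k] Q ⊗[k] k[T;T⁻¹]} {f : R →ₐ[k] Q}
    (hf : Intertwines ρ σ f) {D : Set R} (hD : D ⊆ coinvariants ρ) :
    adjoinInverses f (coinvariants ρ) D ≤ coinvariants σ := by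
  refine Algebra.adjoin_le (Set.union_subset ?_ ?_)
  · rintro _ ⟨u, hu, rfl⟩
    exact mem_coinvariants_iff_weightSpace.2
      (hf.map_mem_weightSpace (mem_coinvariants_iff_weightSpace.1 hu))
  · rintro x ⟨d, hd, h1, h2⟩
    have := inverse_mem_weightSpace
      (hf.map_mem_weightSpace (mem_coinvariants_iff_weightSpace.1 (hD hd))) h1 h2
    rw [neg_zero] at this
    exact mem_coinvariants_iff_weightSpace.2 this

end Coaction

section Fractions

variable (k) in
/-- `N` is a commutative right denominator set that contains multiples of all elements of `S` and
whose elements become invertible in `R[S⁻¹]`. -/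
structure IsDenominatorSet (S : Set R) (N : Submonoid R) : Prop where
  comm : ∀ m ∈ N, ∀ n ∈ N, Commute m n
  ore : ∀ m ∈ N, ∀ p, ∃ m' ∈ N, ∃ p', m * p' = p * m'
  multiple : ∀ s ∈ S, ∃ p, s * p ∈ N
  isUnit : ∀ m ∈ N, IsUnit (Loc.of k S m)

/-- The Ore condition propagates from generators to products by applying it twice, and to sums
because commuting denominators have the common multiple `m₁ m₂`. -/
theorem ore_of_adjoin {N : Submonoid R} (hcomm : ∀ m ∈ N, ∀ n ∈ N, Commute m n) {s : Set R}
    (hs : Algebra.adjoin k s = ⊤) (h : ∀ m ∈ N, ∀ p ∈ s, ∃ m' ∈ N, m * p = p * m') :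
    ∀ m ∈ N, ∀ p, ∃ m' ∈ N, ∃ p', m * p' = p * m' := by
  intro m hm p
  have hp : p ∈ Algebra.adjoin k s := hs ▸ trivial
  induction hp using Algebra.adjoin_induction generalizing m with
  | mem p hp =>
    obtain ⟨m', hm', h⟩ := h m hm p hp
    exact ⟨m', hm', p, h⟩
  | algebraMap r => exact ⟨m, hm, algebraMap k R r, (Algebra.commutes r m).symm⟩
  | add p₁ p₂ _ _ h₁ h₂ =>
    obtain ⟨m₁, hm₁, p₁', h₁⟩ := h₁ m hm
    obtain ⟨m₂, hm₂, p₂', h₂⟩ := h₂ m hm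
    refine ⟨m₁ * m₂, mul_mem hm₁ hm₂, p₁' * m₂ + p₂' * m₁, ?_⟩
    rw [mul_add, ← mul_assoc, ← mul_assoc, h₁, h₂, add_mul, mul_assoc, mul_assoc,
      (hcomm m₂ hm₂ m₁ hm₁).eq]
  | mul p₁ p₂ _ _ h₁ h₂ =>
    obtain ⟨m₁, hm₁, p₁', h₁⟩ := h₁ m hm
    obtain ⟨m₂, hm₂, p₂', h₂⟩ := h₂ m₁ hm₁
    exact ⟨m₂, hm₂, p₁' * p₂', by rw [← mul_assoc, h₁, mul_assoc, h₂, mul_assoc]⟩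

variable {N : Submonoid R}

/-- Right fractions form a subalgebra by the Ore condition and commutativity of `N`. It contains
`s⁻¹`, since `s⁻¹ (s p) = p` and some `s p` is a denominator. -/
theorem IsDenominatorSet.exists_mul_eq (hN : IsDenominatorSet k S N) (x : Loc k S) :
    ∃ m ∈ N, ∃ p, x * Loc.of k S m = Loc.of k S p := by
  let C : Subalgebra k (Loc k S) :=
    { carrier := {x | ∃ m ∈ N, ∃ p, x * Loc.of k S m = Loc.of k S p}
      mul_mem' := by
        rintro x y ⟨m, hm, p, hx⟩ ⟨n, hn, r, hy⟩
        obtain ⟨m', hm', r', h⟩ := hN.ore m hm r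
        -- From `x m = p`, `y n = r` and `m r' = r m'` follows `x y n m' = x r m' = x m r' = p r'`.
        refine ⟨n * m', mul_mem hn hm', p * r', ?_⟩
        rw [map_mul, mul_assoc, ← mul_assoc y, hy, ← map_mul, ← h, map_mul, ← mul_assoc, hx,
          map_mul]
      add_mem' := by
        rintro x y ⟨m, hm, p, hx⟩ ⟨n, hn, r, hy⟩
        refine ⟨m * n, mul_mem hm hn, p * n + r * m, ?_⟩
        have hmn : Loc.of k S n * Loc.of k S m = Loc.of k S m * Loc.of k S n := by
          rw [← map_mul, ← map_mul, (hN.comm n hn m hm).eq]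
        rw [map_add, map_mul, map_mul, map_mul, ← hx, ← hy, add_mul, mul_assoc, mul_assoc, hmn]
      algebraMap_mem' := fun r => ⟨1, one_mem N, algebraMap k R r, by simp⟩ }
  refine Loc.induction_on (C := C) (fun r => ⟨1, one_mem N, r, by simp⟩) (fun s => ?_) x
  obtain ⟨p, hp⟩ := hN.multiple s s.2
  exact ⟨_, hp, p, by rw [map_mul, ← mul_assoc, Loc.inv_mul_of, one_mul]⟩

/-- If `f` kills a fraction it kills the numerator, which therefore vanishes. -/
theorem IsDenominatorSet.injective (hN : IsDenominatorSet k S N) {f : Loc k S →ₐ[k] Q}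
    (hf : Function.Injective (f.comp (Loc.of k S))) : Function.Injective f := by
  refine (injective_iff_map_eq_zero f).2 fun x hx => ?_
  obtain ⟨m, hm, p, h⟩ := hN.exists_mul_eq x
  have hp : p = 0 := hf (by rw [AlgHom.comp_apply, ← h, map_mul, hx, zero_mul, map_zero])
  rwa [hp, map_zero, (hN.isUnit m hm).mul_left_eq_zero] at h

/-- If `x m = p` with `x` and `m` invariant, then `p` is invariant too, and `x = p m⁻¹` lies in any
`C` that contains the invariants of `R` and the inverses of `N`. -/
theorem IsDenominatorSet.coinvariants_le (hN : IsDenominatorSet k S N)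
    {ρ : R →ₐ[k] R ⊗[k] k[T;T⁻¹]} (hS : ∀ s ∈ S, ∃ n : ℤ, ρ s = s ⊗ₜ T n)
    (hinj : Function.Injective (Loc.of k S)) (hNρ : ∀ m ∈ N, m ∈ coinvariants ρ)
    {C : Subalgebra k (Loc k S)} (hC : ∀ u ∈ coinvariants ρ, Loc.of k S u ∈ C)
    (hinv : ∀ m ∈ N, ∃ y ∈ C, Loc.of k S m * y = 1) :
    coinvariants (Loc.coaction k S ρ hS) ≤ C := by
  intro x hx
  obtain ⟨m, hm, p, h⟩ := hN.exists_mul_eq x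
  have hm' := (Loc.intertwines_of hS).map_mem_weightSpace
    (mem_coinvariants_iff_weightSpace.1 (hNρ m hm))
  have hp : p ∈ coinvariants ρ := by
    refine mem_coinvariants_of_map (Loc.intertwines_of hS) hinj ?_
    rw [← h]
    exact mul_mem hx (mem_coinvariants_iff_weightSpace.2 hm')
  obtain ⟨y, hy, hmy⟩ := hinv m hm
  have hxy : x = Loc.of k S p * y := by rw [← h, mul_assoc, hmy, mul_one]
  rw [hxy]
  exact mul_mem (hC p hp) hy

end Fractions

/-- Elements over two charts with comaximal denominators that agree on the overlap glue. -/
theorem exists_glue {P₀ P₁ : Type*} [Ring P₀] [Algebra k P₀] [Ring P₁] [Algebra k P₁]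
    {i₀ : R →ₐ[k] P₀} {i₁ : R →ₐ[k] P₁} {r₀ : P₀ →ₐ[k] Q} {r₁ : P₁ →ₐ[k] Q}
    (h₀ : Function.Injective r₀) (h₁ : Function.Injective r₁) (hr : r₀.comp i₀ = r₁.comp i₁)
    {u₀ : P₀} {u₁ : P₁} {m₀ m₁ p₀ p₁ a b : R} (hu₀ : u₀ * i₀ m₀ = i₀ p₀)
    (hu₁ : u₁ * i₁ m₁ = i₁ p₁) (hab : m₀ * a + m₁ * b = 1) (hu : r₀ u₀ = r₁ u₁) :
    ∃ u, i₀ u = u₀ ∧ i₁ u = u₁ := by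
  have hr' : ∀ x, r₀ (i₀ x) = r₁ (i₁ x) := DFunLike.congr_fun hr
  have hab' : r₁ (i₁ m₀) * r₁ (i₁ a) + r₁ (i₁ m₁) * r₁ (i₁ b) = 1 := by
    simpa using congrArg (fun x => r₁ (i₁ x)) hab
  -- On the overlap, with `u` the common image of `u₀` and `u₁`, `p₀ a + p₁ b = u (m₀ a + m₁ b) =
  -- u`.
  have e₁ : r₁ (i₁ (p₀ * a + p₁ * b)) = r₁ u₁ := by
    rw [map_add, map_mul, map_mul, map_add, map_mul, map_mul, ← hu₁, ← hr' p₀, ← hu₀, map_mul,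
      map_mul, hr', hu, mul_assoc, mul_assoc, ← mul_add, hab', mul_one]
  exact ⟨p₀ * a + p₁ * b, h₀ (by rw [hr', e₁, hu]), h₁ e₁⟩

end Localization

/-! ### Powers of elements that commute up to a scalar -/

section Commutation

variable {k R : Type*} [Field k] [Ring R] [Algebra k R] {x y : R} {c : k}

theorem pow_mul_of_smul_comm (h : x * y = c • (y * x)) (n : ℕ) :
    x ^ n * y = c ^ n • (y * x ^ n) := by
  induction n with
  | zero => simp
  | succ n ih =>
    rw [pow_succ, mul_assoc, h, mul_smul_comm, ← mul_assoc, ih, smul_mul_assoc, smul_smul,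
      mul_assoc, pow_succ, mul_comm c]

theorem mul_pow_of_smul_comm (h : x * y = c • (y * x)) (n : ℕ) :
    x * y ^ n = c ^ n • (y ^ n * x) := by
  induction n with
  | zero => simp
  | succ n ih =>
    rw [pow_succ, ← mul_assoc, ih, smul_mul_assoc, mul_assoc, h, mul_smul_comm, smul_smul,
      mul_assoc, pow_succ]

/-- Up to a power of `c`, `xⁿ yⁿ` is `(x y)ⁿ`; arguing in this direction needs no inverse of `c`. -/
theorem pow_mul_pow_mem {C : Subalgebra k R} (h : x * y = c • (y * x)) (hC : x * y ∈ C) (n : ℕ) :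
    x ^ n * y ^ n ∈ C := by
  induction n with
  | zero => simp
  | succ n ih =>
    have e : x ^ (n + 1) * y ^ (n + 1) = c ^ n • ((x * y) * (x ^ n * y ^ n)) := by
      rw [pow_succ' x, pow_succ' y, mul_assoc, ← mul_assoc (x ^ n), pow_mul_of_smul_comm h,
        smul_mul_assoc, mul_smul_comm]
      simp only [mul_assoc]
    rw [e]
    exact C.smul_mem (mul_mem hC ih) _

end Commutation

/-! ### Ordered monomials span -/

namespace SUq2

variable {k : Type*} [Field k] (q : k)

/-- The powers of `α`, and of `δ` in place of its inverse. -/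
def diagPow (i : ℤ) : SUq2 q := gen q .α ^ i.toNat * gen q .δ ^ (-i).toNat

/-- The monomials `αⁱ βʲ γˡ` and `δⁱ βʲ γˡ`. -/
def monomial (i : ℤ) (j l : ℕ) : SUq2 q := diagPow q i * gen q .β ^ j * gen q .γ ^ l

theorem diagPow_natCast (n : ℕ) : diagPow q n = gen q .α ^ n := by simp [diagPow]

theorem diagPow_neg_natCast (n : ℕ) : diagPow q (-n) = gen q .δ ^ n := by simp [diagPow]

variable {q}

theorem mul_diagPow {x : SUq2 q} (hα : x * gen q .α = q⁻¹ • (gen q .α * x))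
    (hδ : x * gen q .δ = q • (gen q .δ * x)) (i : ℤ) :
    x * diagPow q i = q ^ (-i) • (diagPow q i * x) := by
  obtain ⟨n, rfl | rfl⟩ := i.eq_nat_or_neg
  · rw [diagPow_natCast, mul_pow_of_smul_comm hα, zpow_neg, zpow_natCast, inv_pow]
  · rw [diagPow_neg_natCast, mul_pow_of_smul_comm hδ, neg_neg, zpow_natCast]

variable (q) in
/-- The span of the monomials of degree congruent to `e` modulo two. -/
def paritySpan (e : ℤ) : Submodule k (SUq2 q) :=
  Submodule.span k {u | ∃ (i : ℤ) (j l : ℕ), Even (i + j + l + e) ∧ u = monomial q i j l}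

theorem monomial_mem_paritySpan {e i : ℤ} {j l : ℕ} (h : Even (i + j + l + e)) :
    monomial q i j l ∈ paritySpan q e := Submodule.subset_span ⟨i, j, l, h, rfl⟩

theorem commute_beta_gamma : Commute (gen q .β) (gen q .γ) := rel_bc q

theorem beta_mul_monomial (hq : q ≠ 0) (i : ℤ) (j l : ℕ) :
    gen q .β * monomial q i j l = q ^ (-i) • monomial q i (j + 1) l := by
  rw [monomial, ← mul_assoc, ← mul_assoc, mul_diagPow (gen_ba hq) (rel_bd q), smul_mul_assoc,
    smul_mul_assoc, mul_assoc _ (gen q .β), ← pow_succ']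
  rfl

theorem gamma_mul_monomial (hq : q ≠ 0) (i : ℤ) (j l : ℕ) :
    gen q .γ * monomial q i j l = q ^ (-i) • monomial q i j (l + 1) := by
  rw [monomial, ← mul_assoc, ← mul_assoc, mul_diagPow (gen_ca hq) (rel_cd q), smul_mul_assoc,
    smul_mul_assoc, mul_assoc _ (gen q .γ), (commute_beta_gamma.symm.pow_right j).eq, ← mul_assoc,
    mul_assoc, ← pow_succ']
  rfl

theorem beta_gamma_mul_monomial (hq : q ≠ 0) (i : ℤ) (j l : ℕ) :
    gen q .β * gen q .γ * monomial q i j l = q ^ (-(2 * i)) • monomial q i (j + 1) (l + 1) := by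
  rw [mul_assoc, gamma_mul_monomial hq, mul_smul_comm, beta_mul_monomial hq, smul_smul,
    ← zpow_add₀ hq]
  congr 2
  ring

/-- For `i ≥ 0` this only adds a power of `α`, with `c = 0`; for `i < 0` the `α` meets a `δ`, and
`αδ = 1 + qβγ` gives the second term. -/
theorem alpha_mul_monomial (hq : q ≠ 0) (i : ℤ) (j l : ℕ) : ∃ c : k,
    gen q .α * monomial q i j l =
      monomial q (i + 1) j l + c • monomial q (i + 1) (j + 1) (l + 1) := by
  rcases le_or_gt 0 i with hi | hi
  · lift i to ℕ using hi
    refine ⟨0, ?_⟩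
    rw [zero_smul, add_zero, monomial, monomial, diagPow_natCast,
      show (i : ℤ) + 1 = ((i + 1 : ℕ) : ℤ) by push_cast; rfl, diagPow_natCast, pow_succ']
    simp only [mul_assoc]
  · obtain ⟨n, rfl⟩ : ∃ n : ℕ, i = -(n + 1 : ℕ) := ⟨(-i - 1).toNat, by omega⟩
    refine ⟨q * q ^ (-(2 * -(n : ℤ))), ?_⟩
    rw [monomial, diagPow_neg_natCast, pow_succ', ← mul_assoc, ← mul_assoc, ← mul_assoc, gen_ad,
        ← diagPow_neg_natCast, show -((n + 1 : ℕ) : ℤ) + 1 = -n by push_cast; ring, mul_assoc,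
        mul_assoc, ← mul_assoc (diagPow _ _), ← monomial, add_mul, one_mul, smul_mul_assoc,
        beta_gamma_mul_monomial hq, smul_smul]

theorem delta_mul_monomial (hq : q ≠ 0) (i : ℤ) (j l : ℕ) : ∃ c : k,
    gen q .δ * monomial q i j l =
      monomial q (i - 1) j l + c • monomial q (i - 1) (j + 1) (l + 1) := by
  rcases le_or_gt i 0 with hi | hi
  · obtain ⟨n, rfl⟩ : ∃ n : ℕ, i = -n := ⟨(-i).toNat, by omega⟩
    refine ⟨0, ?_⟩
    rw [zero_smul, add_zero, monomial, monomial, diagPow_neg_natCast,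
      show -(n : ℤ) - 1 = -((n + 1 : ℕ) : ℤ) by push_cast; ring, diagPow_neg_natCast, pow_succ']
    simp only [mul_assoc]
  · obtain ⟨n, rfl⟩ : ∃ n : ℕ, i = (n + 1 : ℕ) := ⟨(i - 1).toNat, by omega⟩
    refine ⟨q⁻¹ * q ^ (-(2 * (n : ℤ))), ?_⟩
    rw [monomial, diagPow_natCast, pow_succ', ← mul_assoc, ← mul_assoc, ← mul_assoc, gen_da,
        ← diagPow_natCast, show ((n + 1 : ℕ) : ℤ) - 1 = n by push_cast; ring, mul_assoc,
        mul_assoc, ← mul_assoc (diagPow _ _), ← monomial, add_mul, one_mul, smul_mul_assoc,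
        beta_gamma_mul_monomial hq, smul_smul]

theorem gen_mul_mem_paritySpan (hq : q ≠ 0) (x : Gen) {e : ℤ} {u : SUq2 q}
    (hu : u ∈ paritySpan q e) : gen q x * u ∈ paritySpan q (e + 1) := by
  refine (Submodule.span_le (p := (paritySpan q (e + 1)).comap (LinearMap.mulLeft k (gen q x)))).2
    ?_ hu
  rintro _ ⟨i, j, l, ⟨m, hm⟩, rfl⟩
  change gen q x * monomial q i j l ∈ paritySpan q (e + 1)
  cases x with
  | α =>
    obtain ⟨c, hc⟩ := alpha_mul_monomial hq i j l
    rw [hc]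
    exact add_mem (monomial_mem_paritySpan ⟨m + 1, by linarith⟩)
      (Submodule.smul_mem _ _ (monomial_mem_paritySpan ⟨m + 2, by push_cast; linarith⟩))
  | β =>
    rw [beta_mul_monomial hq]
    exact Submodule.smul_mem _ _ (monomial_mem_paritySpan ⟨m + 1, by push_cast; linarith⟩)
  | γ =>
    rw [gamma_mul_monomial hq]
    exact Submodule.smul_mem _ _ (monomial_mem_paritySpan ⟨m + 1, by push_cast; linarith⟩)
  | δ =>
    obtain ⟨c, hc⟩ := delta_mul_monomial hq i j l
    rw [hc]
    exact add_mem (monomial_mem_paritySpan ⟨m, by linarith⟩)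
      (Submodule.smul_mem _ _ (monomial_mem_paritySpan ⟨m + 1, by push_cast; linarith⟩))

/-- Left multiplication by a generator maps a parity span into the one of opposite parity, so left
multiplication by `SO_q(3)` preserves the even span; apply this to `1`. -/
theorem mem_span_monomial (hq : q ≠ 0) {u : SUq2 q} (hu : u ∈ SOq3 q) :
    u ∈ Submodule.span k (Set.range fun x : Σ _ : ℤ, ℕ × ℕ => monomial q x.1 x.2.1 x.2.2) := by
  have h : ∀ v ∈ paritySpan q 0, u * v ∈ paritySpan q 0 := by
    induction hu using Algebra.adjoin_induction with
    | mem u hu =>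
      obtain ⟨x, y, rfl⟩ := hu
      intro v hv
      have := gen_mul_mem_paritySpan hq x (gen_mul_mem_paritySpan hq y hv)
      rw [← mul_assoc] at this
      refine Submodule.span_mono ?_ this
      rintro _ ⟨i, j, l, ⟨m, hm⟩, rfl⟩
      -- Two generators have raised the parity index to `0 + 1 + 1`, which is removed by `m - 1`.
      exact ⟨i, j, l, ⟨m - 1, by linarith⟩, rfl⟩
    | algebraMap r =>
      intro v hv
      rw [← Algebra.smul_def]
      exact Submodule.smul_mem _ _ hv
    | add a b _ _ ha hb => exact fun v hv => by simpa [add_mul] using add_mem (ha v hv) (hb v hv)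
    | mul a b _ _ ha hb => exact fun v hv => by simpa [mul_assoc] using ha _ (hb v hv)
  have h1 : (1 : SUq2 q) ∈ paritySpan q 0 := by
    have : monomial q 0 0 0 ∈ paritySpan q 0 := monomial_mem_paritySpan (by simp)
    simpa [monomial, diagPow] using this
  have h2 := h 1 h1
  rw [mul_one] at h2
  refine Submodule.span_mono ?_ h2
  rintro _ ⟨i, j, l, -, rfl⟩
  exact ⟨⟨i, j, l⟩, rfl⟩

end SUq2

/-! ## A faithful representation by weighted shifts -/

section WeightedShift

variable {K : Type*} [Field K]

/-- The operator `f ↦ (i ↦ d i * f (i - n))` on sequences. -/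
def weightedShift (n : ℤ) (d : ℤ → K) : Module.End K (ℤ → K) where
  toFun f i := d i * f (i - n)
  map_add' f g := by ext; simp [mul_add]
  map_smul' c f := by ext; simp [mul_left_comm]

theorem weightedShift_apply (n : ℤ) (d f : ℤ → K) (i : ℤ) :
    weightedShift n d f i = d i * f (i - n) := rfl

theorem weightedShift_mul (m n : ℤ) (d e : ℤ → K) :
    weightedShift m d * weightedShift n e = weightedShift (m + n) fun i => d i * e (i - m) := by
  refine LinearMap.ext fun f => funext fun i => ?_
  simp only [Module.End.mul_apply, weightedShift_apply]
  rw [mul_assoc, sub_sub]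

theorem weightedShift_zero_one : weightedShift 0 (fun _ => (1 : K)) = 1 := by
  refine LinearMap.ext fun f => funext fun i => ?_
  simp [weightedShift_apply]

theorem smul_weightedShift {k : Type*} [Field k] [Algebra k K] (c : k) (n : ℤ) (d : ℤ → K) :
    c • weightedShift n d = weightedShift n fun i => algebraMap k K c * d i := by
  refine LinearMap.ext fun f => funext fun i => ?_
  simp [weightedShift_apply, Algebra.smul_def, mul_assoc]

theorem weightedShift_single (n m : ℤ) (d : ℤ → K) (c : K) :
    weightedShift n d (Pi.single m c) = Pi.single (m + n) (d (m + n) * c) := by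
  ext i
  by_cases h : i = m + n
  · subst h
    simp [weightedShift_apply]
  · have h' : i - n ≠ m := fun h' => h (by omega)
    simp [weightedShift_apply, h, h']

theorem isUnit_weightedShift (n : ℤ) {d : ℤ → K} (hd : ∀ i, d i ≠ 0) :
    IsUnit (weightedShift n d) := by
  refine ⟨⟨weightedShift n d, weightedShift (-n) fun i => (d (i + n))⁻¹, ?_, ?_⟩, rfl⟩ <;>
  · rw [weightedShift_mul]
    simp [hd, weightedShift_zero_one]

theorem exists_weightedShift_pow (n : ℤ) {d : ℤ → K} (hd : ∀ i, d i ≠ 0) (m : ℕ) :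
    ∃ e : ℤ → K, (∀ i, e i ≠ 0) ∧ weightedShift n d ^ m = weightedShift (m * n) e := by
  induction m with
  | zero => exact ⟨fun _ => 1, fun _ => one_ne_zero, by simp [weightedShift_zero_one]⟩
  | succ m ih =>
    obtain ⟨e, he, h⟩ := ih
    refine ⟨fun i => e i * d (i - m * n), fun i => mul_ne_zero (he i) (hd _), ?_⟩
    rw [pow_succ, h, weightedShift_mul]
    congr 1
    push_cast
    ring

end WeightedShift

namespace SUq2

variable {k : Type*} [Field k] (q : k)

/-- The field of rational functions in two variables. -/
abbrev Coeff (k : Type*) [Field k] := FractionRing (MvPolynomial (Fin 2) k)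

/-- The two variables. -/
def coeffVar (k : Type*) [Field k] (i : Fin 2) : Coeff k :=
  algebraMap (MvPolynomial (Fin 2) k) (Coeff k) (MvPolynomial.X i)

theorem coeffVar_ne_zero (i : Fin 2) : coeffVar k i ≠ 0 :=
  (map_ne_zero_iff _ (IsFractionRing.injective _ _)).2 (MvPolynomial.X_ne_zero i)

/-- The constant coefficient is `1`. This is what makes `δ` act invertibly. -/
theorem one_add_ne_zero (c : k) :
    1 + algebraMap k (Coeff k) c * (coeffVar k 0 * coeffVar k 1) ≠ 0 := by
  have h : 1 + algebraMap k (Coeff k) c * (coeffVar k 0 * coeffVar k 1) =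
      algebraMap (MvPolynomial (Fin 2) k) (Coeff k)
        (1 + MvPolynomial.C c * (MvPolynomial.X 0 * MvPolynomial.X 1)) := by
    rw [IsScalarTower.algebraMap_apply k (MvPolynomial (Fin 2) k) (Coeff k)]
    simp [coeffVar, MvPolynomial.algebraMap_eq]
  rw [h]
  refine (map_ne_zero_iff _ (IsFractionRing.injective _ _)).2 fun h0 => ?_
  simpa using congrArg MvPolynomial.constantCoeff h0

/-- The shift and the weights that represent a generator. -/
def repGen : Gen → Module.End (Coeff k) (ℤ → Coeff k)
  | .α => weightedShift 1 fun _ => 1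
  | .β => weightedShift 0 fun i => algebraMap k _ (q ^ (-i)) * coeffVar k 0
  | .γ => weightedShift 0 fun i => algebraMap k _ (q ^ (-i)) * coeffVar k 1
  | .δ => weightedShift (-1) fun i =>
      1 + algebraMap k _ (q ^ (-1 - 2 * i)) * (coeffVar k 0 * coeffVar k 1)

variable {q}

/-- The representation of `SU_q(2)` by weighted shifts. -/
def rep (hq : q ≠ 0) : SUq2 q →ₐ[k] Module.End (Coeff k) (ℤ → Coeff k) := by
  have hq' : algebraMap k (Coeff k) q ≠ 0 := (map_ne_zero _).2 hq
  refine lift q (repGen q) ?_ ?_ ?_ ?_ ?_ ?_ ?_ <;>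
  · refine LinearMap.ext fun f => funext fun i => ?_
    simp only [repGen, weightedShift_mul, smul_weightedShift, LinearMap.add_apply,
      LinearMap.sub_apply, weightedShift_apply, Pi.add_apply, Pi.sub_apply, Module.End.one_apply,
      map_zpow₀, map_sub, map_inv₀, sub_zero, two_mul, sub_neg_eq_add, zpow_sub₀ hq', zpow_neg,
      zpow_add₀ hq', zpow_one, add_neg_cancel, neg_add_cancel, zero_add, add_zero]
    field_simp
    try ring_nf

end SUq2

namespace SUq2

variable {k : Type*} [Field k] {q : k}

theorem rep_gen (hq : q ≠ 0) (x : Gen) : rep hq (gen q x) = repGen q x := by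
  simp only [rep, lift_gen]

theorem isUnit_rep_gen (hq : q ≠ 0) (x : Gen) : IsUnit (rep hq (gen q x)) := by
  have h : ∀ n : ℤ, ∀ j, algebraMap k (Coeff k) (q ^ n) * coeffVar k j ≠ 0 := fun n j =>
    mul_ne_zero ((map_ne_zero _).2 (zpow_ne_zero n hq)) (coeffVar_ne_zero j)
  rw [rep_gen]
  cases x
  · exact isUnit_weightedShift _ fun _ => one_ne_zero
  · exact isUnit_weightedShift _ fun _ => h _ _
  · exact isUnit_weightedShift _ fun _ => h _ _
  · exact isUnit_weightedShift _ fun _ => one_add_ne_zero _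

theorem rep_diagPow (hq : q ≠ 0) (i : ℤ) :
    ∃ d : ℤ → Coeff k, (∀ n, d n ≠ 0) ∧ rep hq (diagPow q i) = weightedShift i d := by
  obtain ⟨n, rfl | rfl⟩ := i.eq_nat_or_neg
  · rw [diagPow_natCast, map_pow, rep_gen]
    simpa [repGen] using exists_weightedShift_pow (K := Coeff k) 1 (fun _ => one_ne_zero) n
  · rw [diagPow_neg_natCast, map_pow, rep_gen]
    simpa [repGen] using exists_weightedShift_pow (K := Coeff k) (-1)
      (fun i => one_add_ne_zero (q ^ (-1 - 2 * i))) n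

theorem weightedShift_pow_single_zero {K : Type*} [Field K] (d : ℤ → K) (n : ℕ) (c : K) :
    (weightedShift 0 d ^ n) (Pi.single 0 c) = Pi.single 0 (d 0 ^ n * c) := by
  induction n with
  | zero => simp
  | succ n ih => rw [pow_succ', Module.End.mul_apply, ih, weightedShift_single, zero_add, pow_succ',
      mul_assoc]

/-- The factor `c` depends on `i` alone: position `i` records the exponent of `α` or `δ`, and the
monomial in the two variables records those of `β` and `γ`. -/
theorem rep_monomial_single (hq : q ≠ 0) (i : ℤ) : ∃ c : Coeff k, c ≠ 0 ∧ ∀ j l : ℕ,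
    rep hq (monomial q i j l) (Pi.single 0 1) =
      Pi.single i (c * (coeffVar k 0 ^ j * coeffVar k 1 ^ l)) := by
  obtain ⟨d, hd, h⟩ := rep_diagPow hq i
  refine ⟨d i, hd i, fun j l => ?_⟩
  rw [monomial, map_mul, map_mul, map_pow, map_pow, h, rep_gen, rep_gen, Module.End.mul_apply,
    Module.End.mul_apply, repGen, repGen, weightedShift_pow_single_zero,
    weightedShift_pow_single_zero, weightedShift_single]
  simp

theorem linearIndependent_coeffVar :
    LinearIndependent k fun x : ℕ × ℕ => coeffVar k 0 ^ x.1 * coeffVar k 1 ^ x.2 := by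
  have h := (MvPolynomial.basisMonomials (Fin 2) k).linearIndependent
  have hinj : Function.Injective fun x : ℕ × ℕ =>
      (Finsupp.single 0 x.1 + Finsupp.single 1 x.2 : Fin 2 →₀ ℕ) := fun x y hxy => by
    have h0 := DFunLike.congr_fun hxy 0
    have h1 := DFunLike.congr_fun hxy 1
    simp at h0 h1
    exact Prod.ext h0 h1
  have h2 := (h.comp _ hinj).map_injOn
    (IsScalarTower.toAlgHom k (MvPolynomial (Fin 2) k) (Coeff k)).toLinearMap
    (IsFractionRing.injective _ _).injOn
  have e : (fun x : ℕ × ℕ => coeffVar k 0 ^ x.1 * coeffVar k 1 ^ x.2) =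
      (IsScalarTower.toAlgHom k (MvPolynomial (Fin 2) k) (Coeff k)).toLinearMap ∘
        MvPolynomial.basisMonomials (Fin 2) k ∘ fun x : ℕ × ℕ =>
          (Finsupp.single 0 x.1 + Finsupp.single 1 x.2 : Fin 2 →₀ ℕ) := funext fun x => by
    simp [coeffVar, MvPolynomial.X_pow_eq_monomial, ← map_mul, ← map_pow, MvPolynomial.monomial_mul]
  rw [e]
  exact h2

/-- Different `i` have disjoint supports; for equal `i` the values are distinct monomials in the
variables times one nonzero factor. -/
theorem linearIndependent_rep_monomial (hq : q ≠ 0) :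
    LinearIndependent k fun x : Σ _ : ℤ, ℕ × ℕ =>
      rep hq (monomial q x.1 x.2.1 x.2.2) (Pi.single 0 1) := by
  choose c hc h using rep_monomial_single hq
  simp only [h]
  refine Pi.linearIndependent_single (R := k) (Ms := fun _ : ℤ => Coeff k)
    (fun i (x : ℕ × ℕ) => c i * (coeffVar k 0 ^ x.1 * coeffVar k 1 ^ x.2)) fun i => ?_
  exact linearIndependent_coeffVar.map_injOn (LinearMap.mulLeft k (c i))
    (mul_right_injective₀ (hc i)).injOn

/-- The representation by weighted shifts is faithful on `SO_q(3)`. -/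
theorem rep_injective (hq : q ≠ 0) : Function.Injective ((rep hq).comp (SOq3 q).val) := by
  refine (injective_iff_map_eq_zero _).2 fun u hu => Subtype.ext ?_
  obtain ⟨c, hc⟩ := Finsupp.mem_span_range_iff_exists_finsupp.1 (mem_span_monomial hq u.2)
  have hu' : rep hq (u : SUq2 q) (Pi.single 0 1) = 0 := by
    rw [show rep hq (u : SUq2 q) = 0 from hu, LinearMap.zero_apply]
  rw [← hc, Finsupp.sum, map_sum, LinearMap.sum_apply] at hu'
  simp only [map_smul, LinearMap.smul_apply] at hu'
  have hc0 : c = 0 := (linearIndependent_iff.1 (linearIndependent_rep_monomial hq)) c hu'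
  rw [← hc, hc0]
  simp

/-! ### Weights of ordered monomials -/

theorem gen_mem_weightSpace (hq : q ≠ 0) (x : Gen) :
    gen q x ∈ weightSpace (coaction q hq) (weight x) := coaction_gen q hq x

theorem pow_mem_weightSpace {P : Type*} [Ring P] [Algebra k P] {ρ : P →ₐ[k] P ⊗[k] k[T;T⁻¹]}
    {u : P} {n : ℤ} (hu : u ∈ weightSpace ρ n) (m : ℕ) : u ^ m ∈ weightSpace ρ (m * n) := by
  rw [mem_weightSpace] at *
  rw [map_pow, hu, Algebra.TensorProduct.tmul_pow, LaurentPolynomial.T_pow]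

theorem monomial_mem_weightSpace (hq : q ≠ 0) (i : ℤ) (j l : ℕ) :
    monomial q i j l ∈ weightSpace (coaction q hq) (i - j + l) := by
  have h := mul_mem_weightSpace (mul_mem_weightSpace (mul_mem_weightSpace
    (pow_mem_weightSpace (gen_mem_weightSpace hq .α) i.toNat)
    (pow_mem_weightSpace (gen_mem_weightSpace hq .δ) (-i).toNat))
    (pow_mem_weightSpace (gen_mem_weightSpace hq .β) j))
    (pow_mem_weightSpace (gen_mem_weightSpace hq .γ) l)
  have e : (i.toNat * weight .α + (-i).toNat * weight .δ + j * weight .β + l * weight .γ : ℤ) =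
      i - j + l := by
    simp only [weight]
    omega
  rwa [e] at h

/-- Weight zero forces the shape `αⁿ βⁿ (βγ)ˡ` or `δⁿ γⁿ (βγ)ʲ`, up to the order of `β` and `γ`; the
products `αβ`, `δγ` and `βγ = q⁻¹(αδ - 1)` lie in the sphere. -/
theorem monomial_mem_sphere (hq : q ≠ 0) {i : ℤ} {j l : ℕ} (h : i - j + l = 0) :
    monomial q i j l ∈ (sphere q).map (SOq3 q).val := by
  set C := (sphere q).map (SOq3 q).val
  have hαβ : gen q .α * gen q .β ∈ C := ⟨bMinus q, Algebra.subset_adjoin (by simp), rfl⟩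
  have hδγ : gen q .δ * gen q .γ ∈ C := by
    rw [gen_dc hq]
    exact C.smul_mem ⟨bPlus q, Algebra.subset_adjoin (by simp), rfl⟩ _
  have hαδ : gen q .α * gen q .δ ∈ C := ⟨b3 q, Algebra.subset_adjoin (by simp), rfl⟩
  have hβγ : gen q .β * gen q .γ ∈ C := by
    have e : gen q .β * gen q .γ = q⁻¹ • (gen q .α * gen q .δ - 1) := by
      rw [gen_ad, add_sub_cancel_left, smul_smul, inv_mul_cancel₀ hq, one_smul]
    rw [e]
    exact C.smul_mem (sub_mem hαδ (one_mem C)) _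
  obtain ⟨n, rfl | rfl⟩ := i.eq_nat_or_neg
  · obtain rfl : j = n + l := by omega
    rw [monomial, diagPow_natCast, pow_add, ← mul_assoc, mul_assoc, ← commute_beta_gamma.mul_pow]
    exact mul_mem (pow_mul_pow_mem (rel_ab q) hαβ n) (pow_mem hβγ l)
  · obtain rfl : l = n + j := by omega
    rw [monomial, diagPow_neg_natCast, mul_assoc, (commute_beta_gamma.pow_pow j _).eq, pow_add,
      mul_assoc (gen q .γ ^ n), ← mul_assoc, ← commute_beta_gamma.symm.mul_pow, ← rel_bc]
    exact mul_mem (pow_mul_pow_mem (gen_dc hq) hδγ n) (pow_mem hβγ j)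

end SUq2

/-! ### The sphere as the invariant subalgebra -/

section WeightProjection

variable {k P : Type*} [Field k] [Ring P] [Algebra k P]

/-- The projection to the elements of weight zero. -/
def weightZero (ρ : P →ₐ[k] P ⊗[k] k[T;T⁻¹]) : P →ₗ[k] P :=
  (TensorProduct.rid k P).toLinearMap ∘ₗ
    (laurentLift (k := k) fun n : ℤ => if n = 0 then (1 : k) else 0).lTensor P ∘ₗ ρ.toLinearMap

theorem weightZero_apply {ρ : P →ₐ[k] P ⊗[k] k[T;T⁻¹]} {n : ℤ} {u : P} (hu : u ∈ weightSpace ρ n) :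
    weightZero ρ u = if n = 0 then u else 0 := by
  rw [mem_weightSpace] at hu
  simp [weightZero, hu]

end WeightProjection

namespace SOq3

variable {k : Type*} [Field k] {q : k}

theorem prod_mem_weightSpace (hq : q ≠ 0) (x y : Gen) (n : ℤ)
    (hn : SUq2.weight x + SUq2.weight y = 2 * n) :
    prod q x y ∈ weightSpace (coaction q hq) n := coaction_apply_prod q hq x y n hn

theorem sphere_eq_coinvariants (hq : q ≠ 0) : sphere q = coinvariants (coaction q hq) := by
  refine le_antisymm (Algebra.adjoin_le ?_) fun u hu => ?_
  · rintro u hu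
    refine mem_coinvariants_iff_weightSpace.2 ?_
    rcases hu with rfl | rfl | rfl <;> exact prod_mem_weightSpace hq _ _ 0 rfl
  · have hu' : (u : SUq2 q) ∈ weightSpace (SUq2.coaction q hq) 0 := by
      rw [mem_weightSpace, ← incl_coaction, mem_coinvariants.1 hu]
      simp [incl]
    have h : (u : SUq2 q) ∈ (sphere q).map (SOq3 q).val := by
      -- An invariant `u` is its own projection to weight zero, so it suffices to project the
      -- spanning monomials, each of which is homogeneous.
      rw [← if_pos (α := SUq2 q) (rfl : (0 : ℤ) = 0) (t := (u : SUq2 q)) (e := 0),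
        ← weightZero_apply hu']
      refine (Submodule.span_le (p := (Subalgebra.toSubmodule ((sphere q).map (SOq3 q).val)).comap
        (weightZero (SUq2.coaction q hq)))).2 ?_ (SUq2.mem_span_monomial hq u.2)
      rintro _ ⟨⟨i, j, l⟩, rfl⟩
      change weightZero (SUq2.coaction q hq) (SUq2.monomial q i j l) ∈ (sphere q).map (SOq3 q).val
      rw [weightZero_apply (SUq2.monomial_mem_weightSpace hq i j l)]
      split_ifs with h
      · exact SUq2.monomial_mem_sphere hq h
      · exact zero_mem _
    obtain ⟨v, hv, hvu⟩ := h
    rwa [← Subtype.ext (a1 := v) (a2 := u) hvu]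

end SOq3

/-! ### The element `βγ` and its commutation relations -/

open Polynomial (aeval)

variable {k : Type*} [Field k] (q : k)

/-- The normal element `βγ`. -/
def betaGamma : SOq3 q := SOq3.prod q .β .γ

/-- The elements `1 + q²ʲ⁺¹ βγ`; for `j = 0, -1` these are `αδ` and `δα`. -/
def den (j : ℤ) : SOq3 q := 1 + q ^ (2 * j + 1) • betaGamma q

/-- The polynomials of which the elements `1 + q²ʲ⁺¹ βγ` are the values at `βγ`. -/
def denPoly (j : ℤ) : Polynomial k := 1 + Polynomial.C (q ^ (2 * j + 1)) * Polynomial.X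

/-- The nonzero multiples of the variable. -/
def varPoly (k : Type*) [Field k] : Set (Polynomial k) :=
  {g | ∃ c : k, c ≠ 0 ∧ g = Polynomial.C c * Polynomial.X}

/-- The multiplicative set generated by the values at `βγ` of given polynomials. -/
def denominators (G : Set (Polynomial k)) : Submonoid (SOq3 q) :=
  (Submonoid.closure G).map (aeval (R := k) (betaGamma q))

/-- The exponent of `q²` in the commutation relation of a generator with `βγ`. -/
def shift : Gen → ℤ
  | .α => -1
  | .β => 0
  | .γ => 0
  | .δ => 1

theorem aeval_denPoly (j : ℤ) : aeval (betaGamma q) (denPoly q j) = den q j := by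
  simp [denPoly, den, Algebra.smul_def]

variable {q}

theorem SUq2.beta_gamma_mul_gen (hq : q ≠ 0) (x : Gen) :
    gen q .β * gen q .γ * gen q x = q ^ (2 * shift x) • (gen q x * (gen q .β * gen q .γ)) := by
  cases x with
  | α =>
    rw [mul_assoc, gen_ca hq, mul_smul_comm, ← mul_assoc, gen_ba hq, smul_mul_assoc, smul_smul,
      mul_assoc, shift, ← mul_inv, ← sq, ← zpow_natCast, ← zpow_neg]
    rfl
  | β => rw [shift, mul_zero, zpow_zero, one_smul, mul_assoc, rel_bc]
  | γ => rw [shift, mul_zero, zpow_zero, one_smul, rel_bc, mul_assoc, rel_bc]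
  | δ =>
    rw [mul_assoc, rel_cd, mul_smul_comm, ← mul_assoc, rel_bd, smul_mul_assoc, smul_smul,
      mul_assoc, shift, ← sq, ← zpow_natCast]
    rfl

theorem betaGamma_mul_prod (hq : q ≠ 0) (x y : Gen) :
    betaGamma q * SOq3.prod q x y =
      q ^ (2 * (shift x + shift y)) • (SOq3.prod q x y * betaGamma q) := by
  refine Subtype.ext ?_
  change SUq2.gen q .β * SUq2.gen q .γ * (SUq2.gen q x * SUq2.gen q y) =
    _ • (SUq2.gen q x * SUq2.gen q y * (SUq2.gen q .β * SUq2.gen q .γ))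
  rw [← mul_assoc, SUq2.beta_gamma_mul_gen hq, smul_mul_assoc, mul_assoc,
    SUq2.beta_gamma_mul_gen hq, mul_smul_comm, smul_smul, ← zpow_add₀ hq, ← mul_add, mul_assoc]

/-- Moving `βγ` past a product rescales it by a power of `q²`, which only shifts the index `j`; the
family of denominators is therefore permuted. -/
theorem den_mul_prod (hq : q ≠ 0) (j : ℤ) (x y : Gen) :
    den q j * SOq3.prod q x y = SOq3.prod q x y * den q (j + (shift x + shift y)) := by
  rw [den, den, add_mul, mul_add, smul_mul_assoc, betaGamma_mul_prod hq, smul_smul,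
    mul_smul_comm, ← zpow_add₀ hq, one_mul, mul_one]
  congr 3
  ring

theorem aeval_mul_of_semiconjBy {R : Type*} [Ring R] [Algebra k R] {p s t : R}
    (h : SemiconjBy p s t) (g : Polynomial k) : aeval t g * p = p * aeval s g := by
  induction g using Polynomial.induction_on' with
  | add f g hf hg => rw [map_add, map_add, add_mul, mul_add, hf, hg]
  | monomial n c =>
    rw [Polynomial.aeval_monomial, Polynomial.aeval_monomial, mul_assoc, ← (h.pow_right n).eq,
      ← mul_assoc, Algebra.commutes, mul_assoc]

theorem SOq3.adjoin_prod : Algebra.adjoin k {u : SOq3 q | ∃ x y, u = SOq3.prod q x y} = ⊤ := by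
  have h := Algebra.adjoin_adjoin_coe_preimage (R := k)
    (s := {u | ∃ x y : Gen, u = SUq2.gen q x * SUq2.gen q y})
  refine eq_top_iff.2 (h.symm.le.trans (Algebra.adjoin_mono ?_))
  rintro u ⟨x, y, hu⟩
  exact ⟨x, y, Subtype.ext hu⟩

theorem SOq3.span_homogeneous (hq : q ≠ 0) :
    Submodule.span k (homogeneous (SOq3.coaction q hq) : Set (SOq3 q)) = ⊤ := by
  refine span_homogeneous_eq_top SOq3.adjoin_prod ?_
  rintro _ ⟨x, y, rfl⟩
  obtain ⟨n, hn⟩ : ∃ n, SUq2.weight x + SUq2.weight y = 2 * n := by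
    cases x <;> cases y <;> first | exact ⟨0, rfl⟩ | exact ⟨1, rfl⟩ | exact ⟨-1, rfl⟩
  exact ⟨n, SOq3.prod_mem_weightSpace hq x y n hn⟩

/-! ### Products of the generators that are polynomials in `βγ` -/

section Products

variable (q)

theorem prod_alpha_delta : SOq3.prod q .α .δ = den q 0 := Subtype.ext <| by
  change SUq2.gen q .α * SUq2.gen q .δ = 1 + q ^ (2 * 0 + 1 : ℤ) • (SUq2.gen q .β * SUq2.gen q .γ)
  rw [SUq2.gen_ad, mul_zero, zero_add, zpow_one]

theorem prod_delta_alpha : SOq3.prod q .δ .α = den q (-1) := Subtype.ext <| by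
  change SUq2.gen q .δ * SUq2.gen q .α =
    1 + q ^ (2 * -1 + 1 : ℤ) • (SUq2.gen q .β * SUq2.gen q .γ)
  rw [SUq2.gen_da, show (2 * -1 + 1 : ℤ) = -1 by norm_num, zpow_neg_one]

theorem prod_gamma_beta : SOq3.prod q .γ .β = betaGamma q := Subtype.ext (SUq2.rel_bc q).symm

theorem betaGamma_mul_prod_gamma_gamma :
    betaGamma q * SOq3.prod q .γ .γ = SOq3.prod q .γ .γ * betaGamma q := by
  refine Subtype.ext ?_
  have h := ((Commute.refl (SUq2.gen q .γ)).mul_right (Commute.refl _))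
  exact ((SUq2.commute_beta_gamma.mul_right SUq2.commute_beta_gamma).mul_left h).eq

theorem commute_betaGamma_den (j : ℤ) : Commute (betaGamma q) (den q j) :=
  (Commute.one_right _).add_right ((Commute.refl _).smul_right _)

theorem prod_mul_prod (x y z w : Gen) (c : k)
    (h : SUq2.gen q y * SUq2.gen q z = c • (SUq2.gen q z * SUq2.gen q y)) :
    SOq3.prod q x y * SOq3.prod q z w = c • (SOq3.prod q x z * SOq3.prod q y w) := by
  refine Subtype.ext ?_
  change SUq2.gen q x * SUq2.gen q y * (SUq2.gen q z * SUq2.gen q w) =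
    c • (SUq2.gen q x * SUq2.gen q z * (SUq2.gen q y * SUq2.gen q w))
  rw [mul_assoc, ← mul_assoc _ _ (SUq2.gen q w), h, smul_mul_assoc, mul_smul_comm]
  simp only [mul_assoc]

theorem beta_beta_mul_gamma_gamma :
    SOq3.prod q .β .β * SOq3.prod q .γ .γ = betaGamma q * betaGamma q := by
  rw [prod_mul_prod q _ _ _ _ 1 (by rw [one_smul, SUq2.rel_bc]), one_smul, betaGamma]

theorem gamma_gamma_mul_beta_beta :
    SOq3.prod q .γ .γ * SOq3.prod q .β .β = betaGamma q * betaGamma q := by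
  rw [prod_mul_prod q _ _ _ _ 1 (by rw [one_smul, SUq2.rel_bc]), one_smul, prod_gamma_beta]

variable {q}

/-- The inner product `y z` is a polynomial in `βγ`; carrying it to the left past `x` shifts its
index by `-shift x`. -/
theorem prod_mul_prod_den (hq : q ≠ 0) (x y z w : Gen) (j : ℤ)
    (h : SUq2.gen q y * SUq2.gen q z =
      1 + q ^ (2 * j + 1) • (SUq2.gen q .β * SUq2.gen q .γ)) :
    SOq3.prod q x y * SOq3.prod q z w = den q (j - shift x) * SOq3.prod q x w := by
  refine Subtype.ext ?_
  change SUq2.gen q x * SUq2.gen q y * (SUq2.gen q z * SUq2.gen q w) =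
    (1 + q ^ (2 * (j - shift x) + 1) • (SUq2.gen q .β * SUq2.gen q .γ)) *
      (SUq2.gen q x * SUq2.gen q w)
  rw [mul_assoc, ← mul_assoc _ _ (SUq2.gen q w), h, add_mul, one_mul, add_mul, one_mul, mul_add,
    smul_mul_assoc, smul_mul_assoc, ← mul_assoc _ (SUq2.gen q x) (SUq2.gen q w),
    SUq2.beta_gamma_mul_gen hq x, mul_smul_comm, smul_mul_assoc, smul_smul, ← zpow_add₀ hq,
    mul_assoc (SUq2.gen q x)]
  congr 3
  ring

theorem SUq2.gen_ad' : gen q .α * gen q .δ =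
    1 + q ^ (2 * (0 : ℤ) + 1) • (gen q .β * gen q .γ) := by
  rw [gen_ad, mul_zero, zero_add, zpow_one]

theorem SUq2.gen_da' : gen q .δ * gen q .α =
    1 + q ^ (2 * (-1 : ℤ) + 1) • (gen q .β * gen q .γ) := by
  rw [gen_da, show (2 * -1 + 1 : ℤ) = -1 by norm_num, zpow_neg_one]

theorem alpha_alpha_mul_delta_delta (hq : q ≠ 0) :
    SOq3.prod q .α .α * SOq3.prod q .δ .δ = den q 1 * den q 0 := by
  rw [prod_mul_prod_den hq _ _ _ _ 0 SUq2.gen_ad', prod_alpha_delta]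
  rfl

theorem delta_delta_mul_alpha_alpha (hq : q ≠ 0) :
    SOq3.prod q .δ .δ * SOq3.prod q .α .α = den q (-2) * den q (-1) := by
  rw [prod_mul_prod_den hq _ _ _ _ (-1) SUq2.gen_da', prod_delta_alpha]
  rfl

theorem bPlus_mul_bMinus (hq : q ≠ 0) : bPlus q * bMinus q = den q (-1) * betaGamma q := by
  rw [bPlus, bMinus, prod_mul_prod_den hq _ _ _ _ (-1) SUq2.gen_da', prod_gamma_beta]
  rfl

theorem prod_beta_mul_prod_gamma (hq : q ≠ 0) (x w : Gen) :
    SOq3.prod q x .β * SOq3.prod q .γ w =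
      q ^ (-(2 * shift x)) • (betaGamma q * SOq3.prod q x w) := by
  refine Subtype.ext ?_
  change SUq2.gen q x * SUq2.gen q .β * (SUq2.gen q .γ * SUq2.gen q w) =
    _ • (SUq2.gen q .β * SUq2.gen q .γ * (SUq2.gen q x * SUq2.gen q w))
  rw [← mul_assoc _ (SUq2.gen q x), SUq2.beta_gamma_mul_gen hq, smul_mul_assoc, smul_smul,
    ← zpow_add₀ hq, neg_add_cancel, zpow_zero, one_smul]
  simp only [mul_assoc]

theorem prod_gamma_mul_prod_beta (hq : q ≠ 0) (x w : Gen) :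
    SOq3.prod q x .γ * SOq3.prod q .β w =
      q ^ (-(2 * shift x)) • (betaGamma q * SOq3.prod q x w) := by
  rw [← prod_beta_mul_prod_gamma hq,
    prod_mul_prod q _ _ _ _ 1 (by rw [one_smul, SUq2.rel_bc]), one_smul]

theorem bMinus_mul_bPlus (hq : q ≠ 0) :
    bMinus q * bPlus q = q ^ (2 : ℤ) • (betaGamma q * den q 0) := by
  rw [bMinus, bPlus, prod_beta_mul_prod_gamma hq, prod_alpha_delta]
  rfl

/-- The determinant relations `δα - q⁻¹βγ = 1` and `αδ - qβγ = 1` prove the analogue in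
half-integral weights; inserting each into itself doubles the weights and stays in even degree. -/
theorem SOq3.stronglyGraded (hq : q ≠ 0) : StronglyGraded (SOq3.coaction q hq) := by
  have hW : ∀ x y n, SUq2.weight x + SUq2.weight y = 2 * n →
      SOq3.prod q x y ∈ weightSpace (SOq3.coaction q hq) n := SOq3.prod_mem_weightSpace hq
  have d0 : den q 0 = 1 + q • betaGamma q := by simp [den]
  have d1 : den q 1 = 1 + q ^ 3 • betaGamma q := by
    rw [den, show (2 * 1 + 1 : ℤ) = (3 : ℕ) by norm_num, zpow_natCast]
  have d2 : den q (-1) = 1 + q⁻¹ • betaGamma q := by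
    rw [den, show (2 * -1 + 1 : ℤ) = -1 by norm_num, zpow_neg_one]
  have d3 : den q (-2) = 1 + q⁻¹ ^ 3 • betaGamma q := by
    rw [den, show (2 * -2 + 1 : ℤ) = -(3 : ℕ) by norm_num, zpow_neg, zpow_natCast, inv_pow]
  refine QuantumBundle.stronglyGraded ?_ ?_
  -- This is `δ (δα - q⁻¹βγ) α - q⁻¹ β (δα - q⁻¹βγ) γ`, where `βδαγ = q² δβγα` merges the two mixed
  -- terms.
  · have e : (1 : SOq3 q) = SOq3.prod q .δ .δ * SOq3.prod q .α .α -
        (q + q⁻¹) • (SOq3.prod q .δ .β * SOq3.prod q .γ .α) +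
        (q⁻¹ ^ 2) • (SOq3.prod q .β .β * SOq3.prod q .γ .γ) := by
      rw [delta_delta_mul_alpha_alpha hq, prod_beta_mul_prod_gamma hq, prod_delta_alpha,
        beta_beta_mul_gamma_gamma, d2, d3, shift,
        show (-(2 * 1) : ℤ) = -(2 : ℕ) by norm_num, zpow_neg, zpow_natCast]
      simp only [mul_add, add_mul, one_mul, mul_one, smul_mul_assoc, mul_smul_comm]
      match_scalars <;> field_simp <;> ring
    rw [e]
    refine add_mem (sub_mem ?_ (Submodule.smul_mem _ _ ?_)) (Submodule.smul_mem _ _ ?_) <;>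
    exact Submodule.mul_mem_mul (hW _ _ _ rfl) (hW _ _ _ rfl)
  -- Likewise `α (αδ - qγβ) δ - q γ (αδ - qγβ) β`, with `γαδβ = q⁻² αγβδ`.
  · have e : (1 : SOq3 q) = SOq3.prod q .α .α * SOq3.prod q .δ .δ -
        (q + q⁻¹) • (SOq3.prod q .α .γ * SOq3.prod q .β .δ) +
        (q ^ 2) • (SOq3.prod q .γ .γ * SOq3.prod q .β .β) := by
      rw [alpha_alpha_mul_delta_delta hq, prod_gamma_mul_prod_beta hq, prod_alpha_delta,
        gamma_gamma_mul_beta_beta, d0, d1, shift,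
        show (-(2 * -1) : ℤ) = (2 : ℕ) by norm_num, zpow_natCast]
      simp only [mul_add, add_mul, one_mul, mul_one, smul_mul_assoc, mul_smul_comm]
      match_scalars <;> field_simp <;> ring
    rw [e]
    refine add_mem (sub_mem ?_ (Submodule.smul_mem _ _ ?_)) (Submodule.smul_mem _ _ ?_) <;>
    exact Submodule.mul_mem_mul (hW _ _ _ rfl) (hW _ _ _ rfl)

end Products

/-! ### Denominators -/

theorem betaGamma_mem_sphere (hq : q ≠ 0) : betaGamma q ∈ sphere q := by
  have e : betaGamma q = q⁻¹ • (b3 q - 1) := by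
    rw [b3, prod_alpha_delta, den, add_sub_cancel_left, mul_zero, zero_add, zpow_one, smul_smul,
      inv_mul_cancel₀ hq, one_smul]
  rw [e]
  exact (sphere q).smul_mem (sub_mem (Algebra.subset_adjoin (by simp)) (one_mem _)) _

theorem one_sub_b3 : 1 - b3 q = -(q • betaGamma q) := by
  rw [b3, prod_alpha_delta, den, mul_zero, zero_add, zpow_one, sub_add_cancel_left]

theorem denominators_le_sphere (hq : q ≠ 0) {G : Set (Polynomial k)} {m : SOq3 q}
    (hm : m ∈ denominators q G) : m ∈ sphere q := by
  obtain ⟨g, -, rfl⟩ := hm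
  exact Algebra.adjoin_le (Set.singleton_subset_iff.2 (betaGamma_mem_sphere hq))
    (Polynomial.aeval_mem_adjoin_singleton k (betaGamma q))

theorem aeval_mem_denominators {G : Set (Polynomial k)} {g : Polynomial k} (hg : g ∈ G) :
    aeval (betaGamma q) g ∈ denominators q G := ⟨g, Submonoid.subset_closure hg, rfl⟩

theorem denominators_induction {G : Set (Polynomial k)} {p : SOq3 q → Prop}
    (one : p 1) (mul : ∀ a b, p a → p b → p (a * b)) (gen : ∀ g ∈ G, p (aeval (betaGamma q) g))
    {m : SOq3 q} (hm : m ∈ denominators q G) : p m := by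
  obtain ⟨g, hg, rfl⟩ := hm
  change p (aeval (betaGamma q) g)
  induction hg using Submonoid.closure_induction with
  | mem g hg => exact gen g hg
  | one => rwa [map_one]
  | mul a b _ _ ha hb =>
    rw [map_mul]
    exact mul _ _ ha hb

/-- Stability under the substitutions `X ↦ q²ⁿ X`. -/
def ScaleStable (q : k) (G : Set (Polynomial k)) : Prop :=
  ∀ g ∈ G, ∀ n : ℤ, g.comp (Polynomial.C (q ^ (2 * n)) * Polynomial.X) ∈ G

theorem scaleStable_denPoly (hq : q ≠ 0) : ScaleStable q (Set.range (denPoly q)) := by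
  rintro _ ⟨j, rfl⟩ n
  refine ⟨j + n, ?_⟩
  rw [denPoly, denPoly, Polynomial.add_comp, Polynomial.mul_comp, Polynomial.C_comp,
    Polynomial.X_comp, Polynomial.one_comp, ← mul_assoc, ← map_mul, ← zpow_add₀ hq]
  congr 4
  ring

theorem scaleStable_varPoly (hq : q ≠ 0) : ScaleStable q (varPoly k) := by
  rintro _ ⟨c, hc, rfl⟩ n
  refine ⟨c * q ^ (2 * n), mul_ne_zero hc (zpow_ne_zero _ hq), ?_⟩
  rw [Polynomial.mul_comp, Polynomial.C_comp, Polynomial.X_comp, ← mul_assoc, ← map_mul]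

theorem ScaleStable.union {G H : Set (Polynomial k)} (hG : ScaleStable q G)
    (hH : ScaleStable q H) : ScaleStable q (G ∪ H) := fun g hg n =>
  hg.imp (fun h => hG g h n) fun h => hH g h n

/-- Denominators commute as values of polynomials at one element. For a product `p` of two
generators, `g(βγ) p = p g(q²ⁿ βγ)`, so stability of `G` under rescaling gives the Ore condition. -/
theorem isDenominatorSet_denominators (hq : q ≠ 0) {S : Set (SOq3 q)} {G : Set (Polynomial k)}
    (hG : ScaleStable q G) (hS : ∀ s ∈ S, ∃ p, s * p ∈ denominators q G)
    (hu : ∀ g ∈ G, IsUnit (Loc.of k S (aeval (betaGamma q) g))) :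
    IsDenominatorSet k S (denominators q G) := by
  have hcomm : ∀ m ∈ denominators q G, ∀ n ∈ denominators q G, Commute m n := by
    rintro _ ⟨f, -, rfl⟩ _ ⟨g, -, rfl⟩
    exact (Commute.all f g).map (aeval (betaGamma q))
  refine ⟨hcomm, ore_of_adjoin hcomm SOq3.adjoin_prod ?_, hS, fun m hm => ?_⟩
  · rintro _ ⟨g, hg, rfl⟩ _ ⟨x, y, rfl⟩
    set n := shift x + shift y
    refine ⟨aeval (betaGamma q) (g.comp (Polynomial.C (q ^ (2 * n)) * Polynomial.X)),
      ⟨_, ?_, rfl⟩, ?_⟩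
    · induction hg using Submonoid.closure_induction with
      | mem g hg => exact Submonoid.subset_closure (hG g hg n)
      | one => simp
      | mul a b _ _ ha hb =>
        rw [Polynomial.mul_comp]
        exact mul_mem ha hb
    · rw [Polynomial.aeval_comp]
      refine aeval_mul_of_semiconjBy ?_ g
      change _ * _ = _ * _
      rw [betaGamma_mul_prod hq]
      simp [Algebra.smul_def, n, (Algebra.commutes _ _ : _ * SOq3.prod q x y = _), ← mul_assoc]
  · exact denominators_induction (p := fun m => IsUnit (Loc.of k S m)) (by simp)
      (fun a b ha hb => by simpa using ha.mul hb) hu hm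

theorem exists_mul_mem_denominators₀ (hq : q ≠ 0) {G : Set (Polynomial k)}
    (hG : Set.range (denPoly q) ⊆ G) : ∀ s ∈ S₀ q, ∃ p, s * p ∈ denominators q G := by
  have hden : ∀ j, den q j ∈ denominators q G := fun j => by
    rw [← aeval_denPoly]
    exact aeval_mem_denominators (hG ⟨j, rfl⟩)
  rintro s (rfl | rfl | rfl | rfl)
  · exact ⟨SOq3.prod q .δ .δ, by
      rw [alpha_alpha_mul_delta_delta hq]; exact mul_mem (hden _) (hden _)⟩
  · exact ⟨1, by rw [mul_one, prod_alpha_delta]; exact hden _⟩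
  · exact ⟨1, by rw [mul_one, prod_delta_alpha]; exact hden _⟩
  · exact ⟨SOq3.prod q .α .α, by
      rw [delta_delta_mul_alpha_alpha hq]; exact mul_mem (hden _) (hden _)⟩

theorem exists_mul_mem_denominators₁ {G : Set (Polynomial k)}
    (hG : varPoly k ⊆ G) : ∀ s ∈ S₁ q, ∃ p, s * p ∈ denominators q G := by
  have ht : betaGamma q ∈ denominators q G := by
    have h := aeval_mem_denominators (q := q) (hG ⟨1, one_ne_zero, rfl⟩)
    rwa [map_one, one_mul, Polynomial.aeval_X] at h
  rintro s (rfl | rfl | rfl | rfl)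
  · exact ⟨SOq3.prod q .γ .γ, by rw [beta_beta_mul_gamma_gamma]; exact mul_mem ht ht⟩
  · exact ⟨1, by rw [mul_one]; exact ht⟩
  · exact ⟨1, by rw [mul_one, prod_gamma_beta]; exact ht⟩
  · exact ⟨SOq3.prod q .β .β, by rw [gamma_gamma_mul_beta_beta]; exact mul_mem ht ht⟩

section Inverses

variable {Q : Type*} [Ring Q] [Algebra k Q] {φ : SOq3 q →ₐ[k] Q}

/-- Conjugation by `α²` shifts the index by two, and `αδ`, `δα` supply one index of each parity. -/
theorem isUnit_map_den (hq : q ≠ 0) (hφ : ∀ s ∈ S₀ q, IsUnit (φ s)) (j : ℤ) :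
    IsUnit (φ (den q j)) := by
  obtain ⟨a, ha⟩ := hφ (SOq3.prod q .α .α) (by simp [S₀])
  have step : ∀ j, IsUnit (φ (den q j)) ↔ IsUnit (φ (den q (j - 2))) := fun j => by
    have h := congrArg φ (den_mul_prod hq j .α .α)
    rw [map_mul, map_mul, ← ha] at h
    rw [← Units.isUnit_mul_units _ a, h, Units.isUnit_units_mul]
    rfl
  suffices H : IsUnit (φ (den q j)) ∧ IsUnit (φ (den q (j - 1))) from H.1
  induction j with
  | zero =>
    refine ⟨?_, ?_⟩
    · rw [← prod_alpha_delta]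
      exact hφ _ (by simp [S₀])
    · rw [show (0 - 1 : ℤ) = -1 by norm_num, ← prod_delta_alpha]
      exact hφ _ (by simp [S₀])
  | succ i hi =>
    refine ⟨(step _).2 ?_, ?_⟩
    · convert! hi.2 using 3
      ring
    · rw [add_sub_cancel_right]
      exact hi.1
  | pred i hi =>
    refine ⟨hi.2, ?_⟩
    have := (step _).1 hi.1
    rwa [show (-(i : ℤ) - 2 : ℤ) = -i - 1 - 1 by ring] at this

theorem isUnit_map_betaGamma (hφ : ∀ s ∈ S₁ q, IsUnit (φ s)) : IsUnit (φ (betaGamma q)) :=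
  hφ _ (by simp [S₁, betaGamma])

variable {C : Subalgebra k Q}

/-- Conjugation by `α²` is not available in `C`, where only `b₃` is inverted. Instead `b_∓`
intertwine neighbouring denominators `vⱼ`, and the products of `b_-` and `b_+` contain the factor
`βγ`, so `C` contains `vⱼ⁻¹ βγ`, step by step in both directions from `j = 0`. -/
theorem exists_inverse_den (hq : q ≠ 0) (hφ : ∀ s ∈ S₀ q, IsUnit (φ s))
    (hC : ∀ u ∈ sphere q, φ u ∈ C) (h0 : ∃ y ∈ C, φ (b3 q) * y = 1) (j : ℤ) :
    ∃ y ∈ C, φ (den q j) * y = 1 := by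
  choose v hv using fun j => isUnit_map_den hq hφ j
  suffices H : ((v j)⁻¹ : Qˣ).val ∈ C from ⟨_, H, by rw [← hv, Units.mul_inv]⟩
  have htC : φ (betaGamma q) ∈ C := hC _ (betaGamma_mem_sphere hq)
  have hbp : φ (bPlus q) ∈ C := hC _ (Algebra.subset_adjoin (by simp))
  have hbm : φ (bMinus q) ∈ C := hC _ (Algebra.subset_adjoin (by simp))
  -- The element `βγ` need not be invertible; it is removed by `vₘ⁻¹ = 1 - q²ᵐ⁺¹ vₘ⁻¹ βγ`.
  have of_mul : ∀ m, ((v m)⁻¹ : Qˣ).val * φ (betaGamma q) ∈ C → ((v m)⁻¹ : Qˣ).val ∈ C := by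
    intro m hm
    have h : ((v m)⁻¹ : Qˣ).val * φ (den q m) = 1 := by rw [← hv, Units.inv_mul]
    rw [den, map_add, map_one, map_smul, mul_add, mul_one, mul_smul_comm] at h
    rw [← eq_sub_iff_add_eq.2 h |>.symm]
    exact sub_mem (one_mem C) (C.smul_mem hm _)
  have semiP : ∀ m, SemiconjBy (φ (bPlus q)) (v (m + 1)) (v m) := fun m => by
    have h := congrArg φ (den_mul_prod hq m .γ .δ)
    rw [map_mul, map_mul, ← hv, ← hv] at h
    exact h.symm
  have semiM : ∀ m, SemiconjBy (φ (bMinus q)) (v m) (v (m + 1)) := fun m => by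
    have h := congrArg φ (den_mul_prod hq (m + 1) .α .β)
    rw [map_mul, map_mul, ← hv, ← hv, show m + 1 + (shift .α + shift .β) = m by
      simp [shift]] at h
    exact h.symm
  have hpm : φ (bPlus q) * φ (bMinus q) = v (-1) * φ (betaGamma q) := by
    rw [← map_mul, bPlus_mul_bMinus hq, map_mul, hv]
  have hmp : φ (bMinus q) * φ (bPlus q) = q ^ (2 : ℤ) • (φ (betaGamma q) * v 0) := by
    rw [← map_mul, bMinus_mul_bPlus hq, map_smul, map_mul, hv]
  have hv0 : ((v 0)⁻¹ : Qˣ).val ∈ C := by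
    obtain ⟨y, hy, h⟩ := h0
    rw [b3, prod_alpha_delta, ← hv] at h
    rwa [Units.inv_eq_of_mul_eq_one_right h]
  induction j with
  | zero => exact hv0
  | succ i hi =>
    refine of_mul _ ?_
    -- Use `b_- vᵢ⁻¹ = vᵢ₊₁⁻¹ b_-` and `b_- b_+ = q² βγ v₀`.
    have e : ((v (i + 1))⁻¹ : Qˣ).val * φ (betaGamma q) = q ^ (-2 : ℤ) •
        (φ (bMinus q) * ((v i)⁻¹ : Qˣ).val * φ (bPlus q) * ((v 0)⁻¹ : Qˣ).val) := by
      rw [(semiM i).units_inv_right.eq, mul_assoc (((v (i + 1))⁻¹ : Qˣ).val), hmp, mul_smul_comm,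
        smul_mul_assoc, smul_smul, ← zpow_add₀ hq, neg_add_cancel, zpow_zero, one_smul,
        ← mul_assoc, Units.mul_inv_cancel_right]
    rw [e]
    exact C.smul_mem (mul_mem (mul_mem (mul_mem hbm hi) hbp) hv0) _
  | pred i hi =>
    refine of_mul _ ?_
    have h := (semiP (-i - 1)).units_inv_right
    have h' := (semiP (-1)).units_inv_right
    rw [sub_add_cancel] at h
    rw [neg_add_cancel] at h'
    -- Here `b_+` lowers the index; it also turns `v₀⁻¹` into `v₋₁⁻¹`, which cancels against `b_+
    -- b_- = v₋₁ βγ`.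
    have e : ((v (-i - 1))⁻¹ : Qˣ).val * φ (betaGamma q) =
        φ (bPlus q) * ((v (-i))⁻¹ : Qˣ).val * ((v 0)⁻¹ : Qˣ).val * φ (bMinus q) := by
      rw [h.eq, mul_assoc (((v (-i - 1))⁻¹ : Qˣ).val), h'.eq, mul_assoc, mul_assoc, hpm,
        Units.inv_mul_cancel_left]
    rw [e]
    exact mul_mem (mul_mem (mul_mem hbp hi) hv0) hbm

theorem exists_inverse_betaGamma (h1 : ∃ y ∈ C, φ (1 - b3 q) * y = 1) :
    ∃ y ∈ C, φ (betaGamma q) * y = 1 := by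
  obtain ⟨y, hy, h⟩ := h1
  refine ⟨-(q • y), neg_mem (C.smul_mem hy _), ?_⟩
  rw [one_sub_b3, map_neg, map_smul] at h
  rw [← h, mul_neg, mul_smul_comm, neg_mul, smul_mul_assoc]

theorem exists_inverse_aeval {G : Set (Polynomial k)}
    (h : ∀ g ∈ G, ∃ y ∈ C, φ (aeval (betaGamma q) g) * y = 1) :
    ∀ m ∈ denominators q G, ∃ y ∈ C, φ m * y = 1 := fun m hm => by
  refine denominators_induction (p := fun m => ∃ y ∈ C, φ m * y = 1) ⟨1, one_mem C, by simp⟩ ?_ h hm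
  rintro a b ⟨x, hx, hax⟩ ⟨y, hy, hby⟩
  refine ⟨y * x, mul_mem hy hx, ?_⟩
  rw [map_mul, mul_assoc, ← mul_assoc _ y, hby, one_mul, hax]

theorem exists_inverse_denPoly (hq : q ≠ 0) (hφ : ∀ s ∈ S₀ q, IsUnit (φ s))
    (hC : ∀ u ∈ sphere q, φ u ∈ C) (h0 : ∃ y ∈ C, φ (b3 q) * y = 1) :
    ∀ g ∈ Set.range (denPoly q), ∃ y ∈ C, φ (aeval (betaGamma q) g) * y = 1 := by
  rintro _ ⟨j, rfl⟩
  rw [aeval_denPoly]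
  exact exists_inverse_den hq hφ hC h0 j

theorem exists_inverse_varPoly (h1 : ∃ y ∈ C, φ (1 - b3 q) * y = 1) :
    ∀ g ∈ varPoly k, ∃ y ∈ C, φ (aeval (betaGamma q) g) * y = 1 := by
  rintro _ ⟨c, hc, rfl⟩
  obtain ⟨y, hy, h⟩ := exists_inverse_betaGamma h1
  refine ⟨c⁻¹ • y, C.smul_mem hy _, ?_⟩
  rw [map_mul, Polynomial.aeval_C, Polynomial.aeval_X, ← Algebra.smul_def, map_smul,
    smul_mul_smul_comm, mul_inv_cancel₀ hc, h, one_smul]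

theorem exists_inverse_of_mem {f : SOq3 q →ₐ[k] Q} {B : Subalgebra k (SOq3 q)} {D : Set (SOq3 q)}
    {d : SOq3 q} (hd : d ∈ D) (hu : IsUnit (f d)) : ∃ y ∈ adjoinInverses f B D, f d * y = 1 := by
  obtain ⟨u, hu⟩ := hu
  have h : f d * ((u⁻¹ : Qˣ) : Q) = 1 := by rw [← hu, Units.mul_inv]
  exact ⟨_, Algebra.subset_adjoin (Or.inr ⟨d, hd, h, by rw [← hu, Units.inv_mul]⟩), h⟩

theorem map_mem_adjoinInverses {f : SOq3 q →ₐ[k] Q} {B : Subalgebra k (SOq3 q)}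
    {D : Set (SOq3 q)} : ∀ u ∈ B, f u ∈ adjoinInverses f B D := fun u hu =>
  Algebra.subset_adjoin (Or.inl ⟨u, hu, rfl⟩)

theorem isUnit_map_b3 (hφ : ∀ s ∈ S₀ q, IsUnit (φ s)) : IsUnit (φ (b3 q)) :=
  hφ _ (by simp [S₀, b3])

theorem isUnit_map_one_sub_b3 (hq : q ≠ 0) (hφ : ∀ s ∈ S₁ q, IsUnit (φ s)) :
    IsUnit (φ (1 - b3 q)) := by
  rw [one_sub_b3, map_neg, map_smul]
  exact ((isUnit_map_betaGamma hφ).smul (Units.mk0 q hq)).neg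

theorem isUnit_map_denPoly (hq : q ≠ 0) (hφ : ∀ s ∈ S₀ q, IsUnit (φ s)) :
    ∀ g ∈ Set.range (denPoly q), IsUnit (φ (aeval (betaGamma q) g)) := by
  rintro _ ⟨j, rfl⟩
  rw [aeval_denPoly]
  exact isUnit_map_den hq hφ j

theorem isUnit_map_varPoly (hφ : ∀ s ∈ S₁ q, IsUnit (φ s)) :
    ∀ g ∈ varPoly k, IsUnit (φ (aeval (betaGamma q) g)) := by
  rintro _ ⟨c, hc, rfl⟩
  rw [map_mul, Polynomial.aeval_C, Polynomial.aeval_X, ← Algebra.smul_def, map_smul]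
  exact (isUnit_map_betaGamma hφ).smul (Units.mk0 c hc)

end Inverses

/-! ### The charts -/

theorem isDenominatorSet₀ (hq : q ≠ 0) :
    IsDenominatorSet k (S₀ q) (denominators q (Set.range (denPoly q))) :=
  isDenominatorSet_denominators hq (scaleStable_denPoly hq)
    (exists_mul_mem_denominators₀ hq subset_rfl) (isUnit_map_denPoly hq fun _ => Loc.isUnit_of)

theorem isDenominatorSet₁ (hq : q ≠ 0) : IsDenominatorSet k (S₁ q) (denominators q (varPoly k)) :=
  isDenominatorSet_denominators hq (scaleStable_varPoly hq)
    (exists_mul_mem_denominators₁ subset_rfl) (isUnit_map_varPoly fun _ => Loc.isUnit_of)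

theorem isUnit_of₀₁_left : ∀ s ∈ S₀ q, IsUnit (of₀₁ q s) := fun _ hs => Loc.isUnit_of (Or.inl hs)

theorem isUnit_of₀₁_right : ∀ s ∈ S₁ q, IsUnit (of₀₁ q s) := fun _ hs => Loc.isUnit_of (Or.inr hs)

theorem isDenominatorSet₀₁ (hq : q ≠ 0) :
    IsDenominatorSet k (S₀ q ∪ S₁ q) (denominators q (Set.range (denPoly q) ∪ varPoly k)) :=
  isDenominatorSet_denominators hq ((scaleStable_denPoly hq).union (scaleStable_varPoly hq))
    (fun s hs => hs.elim (exists_mul_mem_denominators₀ hq Set.subset_union_left s)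
      (exists_mul_mem_denominators₁ Set.subset_union_right s))
    fun g hg => hg.elim (isUnit_map_denPoly hq isUnit_of₀₁_left g)
      (isUnit_map_varPoly isUnit_of₀₁_right g)

/-- The weighted shift representation inverts all generators, hence factors through the double
localization, and it is faithful on `SO_q(3)`. -/
theorem of₀₁_injective (hq : q ≠ 0) : Function.Injective (of₀₁ q) := by
  have hu : ∀ s ∈ S₀ q ∪ S₁ q, IsUnit (((SUq2.rep hq).comp (SOq3 q).val) s) := by
    have h : ∀ x y, IsUnit (((SUq2.rep hq).comp (SOq3 q).val) (SOq3.prod q x y)) := fun x y => by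
      have := (SUq2.isUnit_rep_gen hq x).mul (SUq2.isUnit_rep_gen hq y)
      rwa [← map_mul] at this
    rintro s ((rfl | rfl | rfl | rfl) | (rfl | rfl | rfl | rfl)) <;> exact h _ _
  refine Function.Injective.of_comp (f := Loc.lift _ hu) ?_
  rw [show Loc.lift _ hu ∘ of₀₁ q = (SUq2.rep hq).comp (SOq3 q).val from
    funext fun u => Loc.lift_of _ hu u]
  exact SUq2.rep_injective hq

theorem res₀_injective (hq : q ≠ 0) : Function.Injective (res₀ q) :=
  (isDenominatorSet₀ hq).injective (by rw [Loc.res_comp_of]; exact of₀₁_injective hq)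

theorem res₁_injective (hq : q ≠ 0) : Function.Injective (res₁ q) :=
  (isDenominatorSet₁ hq).injective (by rw [Loc.res_comp_of]; exact of₀₁_injective hq)

theorem res₀_comp_of₀ : (res₀ q).comp (of₀ q) = of₀₁ q := Loc.res_comp_of _

theorem res₁_comp_of₁ : (res₁ q).comp (of₁ q) = of₀₁ q := Loc.res_comp_of _

theorem of₀_injective (hq : q ≠ 0) : Function.Injective (of₀ q) := by
  refine Function.Injective.of_comp (f := res₀ q) ?_
  rw [← AlgHom.coe_comp, res₀_comp_of₀]
  exact of₀₁_injective hq

theorem of₁_injective (hq : q ≠ 0) : Function.Injective (of₁ q) := by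
  refine Function.Injective.of_comp (f := res₁ q) ?_
  rw [← AlgHom.coe_comp, res₁_comp_of₁]
  exact of₀₁_injective hq

/-- A localization of `SO_q(3)` by homogeneous elements is a quantum principal bundle over
`S_q²[D⁻¹]` if the denominators are invertible there. -/
theorem isQuantumPrincipalBundle_loc (hq : q ≠ 0) {S D : Set (SOq3 q)} {G : Set (Polynomial k)}
    (hS : ∀ s ∈ S, ∃ n : ℤ, SOq3.coaction q hq s = s ⊗ₜ T n)
    (hN : IsDenominatorSet k S (denominators q G)) (hinj : Function.Injective (Loc.of k S))
    (hD : D ⊆ sphere q) (hinv : ∀ g ∈ G, ∃ y ∈ adjoinInverses (Loc.of k S) (sphere q) D,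
      Loc.of k S (aeval (betaGamma q) g) * y = 1) :
    IsQuantumPrincipalBundle (Loc.coaction k S (SOq3.coaction q hq) hS)
      (adjoinInverses (Loc.of k S) (sphere q) D) := by
  have hsphere := SOq3.sphere_eq_coinvariants hq
  have hbase : adjoinInverses (Loc.of k S) (sphere q) D =
      coinvariants (Loc.coaction k S (SOq3.coaction q hq) hS) := by
    refine le_antisymm ?_ (hN.coinvariants_le hS hinj (fun m hm => ?_) (fun u hu => ?_)
      (exists_inverse_aeval hinv))
    · rw [hsphere] at hD ⊢
      exact adjoinInverses_le_coinvariants (Loc.intertwines_of hS) hD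
    · exact hsphere ▸ denominators_le_sphere hq hm
    · exact map_mem_adjoinInverses u (hsphere ▸ hu)
  rw [hbase]
  exact isQuantumPrincipalBundle_coinvariants
    (Loc.span_homogeneous hS (SOq3.span_homogeneous hq))
    ((SOq3.stronglyGraded hq).of_intertwines (Loc.intertwines_of hS))

theorem b3_mem_sphere : b3 q ∈ sphere q := Algebra.subset_adjoin (by simp)

theorem one_sub_b3_mem_sphere : 1 - b3 q ∈ sphere q := sub_mem (one_mem _) b3_mem_sphere

theorem bundle₀ (hq : q ≠ 0) : IsQuantumPrincipalBundle (coaction₀ hq) (B₀ q) := by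
  have hu : ∀ s ∈ S₀ q, IsUnit (of₀ q s) := fun _ => Loc.isUnit_of
  exact isQuantumPrincipalBundle_loc hq (homogeneous₀ hq) (isDenominatorSet₀ hq) (of₀_injective hq)
    (Set.singleton_subset_iff.2 b3_mem_sphere)
    (exists_inverse_denPoly hq hu map_mem_adjoinInverses
      (exists_inverse_of_mem rfl (isUnit_map_b3 hu)))

theorem bundle₁ (hq : q ≠ 0) : IsQuantumPrincipalBundle (coaction₁ hq) (B₁ q) := by
  have hu : ∀ s ∈ S₁ q, IsUnit (of₁ q s) := fun _ => Loc.isUnit_of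
  exact isQuantumPrincipalBundle_loc hq (homogeneous₁ hq) (isDenominatorSet₁ hq) (of₁_injective hq)
    (Set.singleton_subset_iff.2 one_sub_b3_mem_sphere)
    (exists_inverse_varPoly (exists_inverse_of_mem rfl (isUnit_map_one_sub_b3 hq hu)))

theorem bundle₀₁ (hq : q ≠ 0) : IsQuantumPrincipalBundle (coaction₀₁ hq) (B₀₁ q) :=
  isQuantumPrincipalBundle_loc hq _ (isDenominatorSet₀₁ hq) (of₀₁_injective hq)
    (Set.insert_subset b3_mem_sphere (Set.singleton_subset_iff.2 one_sub_b3_mem_sphere))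
    fun g hg => hg.elim
      (exists_inverse_denPoly hq isUnit_of₀₁_left map_mem_adjoinInverses
        (exists_inverse_of_mem (Or.inl rfl) (isUnit_map_b3 isUnit_of₀₁_left)) g)
      (exists_inverse_varPoly (exists_inverse_of_mem (Or.inr rfl)
        (isUnit_map_one_sub_b3 hq isUnit_of₀₁_right)) g)

theorem bundle (hq : q ≠ 0) : IsQuantumPrincipalBundle (SOq3.coaction q hq) (sphere q) := by
  rw [SOq3.sphere_eq_coinvariants hq]
  exact isQuantumPrincipalBundle_coinvariants (SOq3.span_homogeneous hq) (SOq3.stronglyGraded hq)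

theorem intertwines_of₀ (hq : q ≠ 0) :
    Intertwines (SOq3.coaction q hq) (coaction₀ hq) (of₀ q) := Loc.intertwines_of _

theorem intertwines_of₁ (hq : q ≠ 0) :
    Intertwines (SOq3.coaction q hq) (coaction₁ hq) (of₁ q) := Loc.intertwines_of _

theorem intertwines_res₀ (hq : q ≠ 0) :
    Intertwines (coaction₀ hq) (coaction₀₁ hq) (res₀ q) := Loc.intertwines_res _ _ _

theorem intertwines_res₁ (hq : q ≠ 0) :
    Intertwines (coaction₁ hq) (coaction₀₁ hq) (res₁ q) := Loc.intertwines_res _ _ _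

/-! ### The trivializing units -/

theorem inv_mul_mem_weightSpace {P : Type*} [Ring P] [Algebra k P]
    {ρ : P →ₐ[k] P ⊗[k] k[T;T⁻¹]} {u v : Pˣ} {m n : ℤ} (hu : (u : P) ∈ weightSpace ρ m)
    (hv : (v : P) ∈ weightSpace ρ n) : ((u⁻¹ * v : Pˣ) : P) ∈ weightSpace ρ (-m + n) := by
  rw [Units.val_mul]
  exact mul_mem_weightSpace (inverse_mem_weightSpace hu u.mul_inv u.inv_mul) hv

theorem neg_mul_inv_mem_weightSpace {P : Type*} [Ring P] [Algebra k P]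
    {ρ : P →ₐ[k] P ⊗[k] k[T;T⁻¹]} {u v : Pˣ} {m n : ℤ} (hu : (u : P) ∈ weightSpace ρ m)
    (hv : (v : P) ∈ weightSpace ρ n) : ((-(u * v⁻¹) : Pˣ) : P) ∈ weightSpace ρ (m + -n) := by
  rw [Units.val_neg, Units.val_mul]
  exact neg_mem (mul_mem_weightSpace hu (inverse_mem_weightSpace hv v.mul_inv v.inv_mul))

theorem transition₀_mem_weightSpace (hq : q ≠ 0) :
    (((unitαδ q)⁻¹ * unitαα q : (P₀ q)ˣ) : P₀ q) ∈ weightSpace (coaction₀ hq) 1 := by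
  have h1 : (unitαδ q : P₀ q) ∈ weightSpace (coaction₀ hq) 0 :=
    (intertwines_of₀ hq).map_mem_weightSpace (SOq3.prod_mem_weightSpace hq .α .δ 0 rfl)
  have h2 : (unitαα q : P₀ q) ∈ weightSpace (coaction₀ hq) 1 :=
    (intertwines_of₀ hq).map_mem_weightSpace (SOq3.prod_mem_weightSpace hq .α .α 1 rfl)
  have h := inv_mul_mem_weightSpace h1 h2
  rwa [neg_zero, zero_add] at h

theorem transition₁_mem_weightSpace (hq : q ≠ 0) :
    ((-(unitγβ q * (unitββ q)⁻¹) : (P₁ q)ˣ) : P₁ q) ∈ weightSpace (coaction₁ hq) 1 := by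
  have h1 : (unitγβ q : P₁ q) ∈ weightSpace (coaction₁ hq) 0 :=
    (intertwines_of₁ hq).map_mem_weightSpace (SOq3.prod_mem_weightSpace hq .γ .β 0 rfl)
  have h2 : (unitββ q : P₁ q) ∈ weightSpace (coaction₁ hq) (-1) :=
    (intertwines_of₁ hq).map_mem_weightSpace (SOq3.prod_mem_weightSpace hq .β .β (-1) rfl)
  have h := neg_mul_inv_mem_weightSpace h1 h2
  rwa [neg_neg, zero_add] at h

theorem Φ₀_T_neg_one (hq : q ≠ 0) :
    Φ₀ q (T (-1)) = ((unitδα q)⁻¹ : (P₀ q)ˣ) * (unitδδ q : P₀ q) := by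
  -- The formula for the inverse amounts to `δ² = (δα) α⁻² (αδ)`; after multiplication by `α²` on
  -- the right both sides are products of the denominators of index `-1` and `-2`.
  have h : unitδδ q * unitαα q = unitδα q * (unitαα q)⁻¹ * unitαδ q * unitαα q := by
    have h1 : unitδδ q * unitαα q = unitδα q * ((unitαα q)⁻¹ * (unitαδ q * unitαα q)) := by
      have hden : (unitαδ q : P₀ q) * unitαα q = unitαα q * of₀ q (den q (-2)) := by
        have := congrArg (of₀ q) (den_mul_prod hq 0 .α .α)
        rwa [map_mul, map_mul, ← prod_alpha_delta] at this
      refine Units.ext ?_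
      rw [Units.val_mul, Units.val_mul, Units.val_mul, Units.val_mul, hden,
        Units.inv_mul_cancel_left]
      have hcomm : den q (-2) * den q (-1) = den q (-1) * den q (-2) :=
        ((Commute.one_left _).add_left ((commute_betaGamma_den q _).smul_left _)).eq
      have := congrArg (of₀ q) ((delta_delta_mul_alpha_alpha hq).trans hcomm)
      rwa [map_mul, map_mul, ← prod_delta_alpha] at this
    rw [h1]
    simp only [mul_assoc]
  have h' : ((unitαδ q)⁻¹ * unitαα q)⁻¹ = (unitδα q)⁻¹ * unitδδ q := by
    rw [mul_right_cancel h]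
    group
  rw [Φ₀, ofUnit_T, zpow_neg_one, h', Units.val_mul]

theorem Φ₁_T_neg_one :
    Φ₁ q (T (-1)) = -((unitβγ q : P₁ q) * ((unitγγ q)⁻¹ : (P₁ q)ˣ)) := by
  have e : unitγβ q = unitβγ q := Units.ext (congrArg (of₁ q) (prod_gamma_beta q))
  have h1 : unitββ q * unitγγ q = unitβγ q * unitβγ q := by
    refine Units.ext ?_
    have := congrArg (of₁ q) (beta_beta_mul_gamma_gamma q)
    rwa [map_mul, map_mul] at this
  have hc : Commute (unitβγ q) (unitγγ q) := by
    refine Units.ext ?_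
    have := congrArg (of₁ q) (betaGamma_mul_prod_gamma_gamma q)
    rwa [map_mul, map_mul] at this
  have h' : (unitγβ q * (unitββ q)⁻¹)⁻¹ = unitβγ q * (unitγγ q)⁻¹ := by
    rw [e, mul_inv_rev, inv_inv, mul_inv_eq_iff_eq_mul, mul_assoc, ← hc.inv_right.eq,
      ← mul_assoc, eq_mul_inv_iff_mul_eq, h1]
  rw [Φ₁, ofUnit_T, zpow_neg_one, inv_neg, h', Units.val_neg, Units.val_mul]

/-! ### Gluing over the two charts -/

theorem isCoprime_of_mem_closure {f g : Polynomial k}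
    (hf : f ∈ Submonoid.closure (Set.range (denPoly q))) (hg : g ∈ Submonoid.closure (varPoly k)) :
    IsCoprime f g := by
  induction hf using Submonoid.closure_induction with
  | one => exact isCoprime_one_left
  | mul a b _ _ ha hb => exact ha.mul_left hb
  | mem f hf =>
    obtain ⟨j, rfl⟩ := hf
    induction hg using Submonoid.closure_induction with
    | one => exact isCoprime_one_right
    | mul a b _ _ ha hb => exact ha.mul_right hb
    | mem g hg =>
      obtain ⟨c, hc, rfl⟩ := hg
      -- Bézout coefficients: subtracting `q²ʲ⁺¹ c⁻¹ · cX` from `1 + q²ʲ⁺¹ X` leaves `1`.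
      refine ⟨1, -Polynomial.C (q ^ (2 * j + 1) * c⁻¹), ?_⟩
      rw [denPoly, one_mul, neg_mul, ← mul_assoc, ← map_mul, inv_mul_cancel_right₀ hc,
        add_neg_cancel_right]

theorem exists_glue_charts (hq : q ≠ 0) (u₀ : P₀ q) (u₁ : P₁ q) (h : res₀ q u₀ = res₁ q u₁) :
    ∃ u, of₀ q u = u₀ ∧ of₁ q u = u₁ := by
  obtain ⟨_, ⟨f, hf, rfl⟩, p₀, h₀⟩ := (isDenominatorSet₀ hq).exists_mul_eq u₀
  obtain ⟨_, ⟨g, hg, rfl⟩, p₁, h₁⟩ := (isDenominatorSet₁ hq).exists_mul_eq u₁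
  obtain ⟨a, b, hab⟩ := isCoprime_of_mem_closure hf hg
  refine exists_glue (res₀_injective hq) (res₁_injective hq)
    (res₀_comp_of₀.trans res₁_comp_of₁.symm) h₀ h₁ (a := aeval (betaGamma q) a)
    (b := aeval (betaGamma q) b) ?_ h
  -- Right fractions need the denominators on the left of the Bézout coefficients; all four elements
  -- are polynomials in `βγ` and commute.
  have := congrArg (aeval (betaGamma q)) hab
  rwa [map_add, map_mul, map_mul, map_one, (Commute.all a f).map (aeval (betaGamma q)) |>.eq,
    (Commute.all b g).map (aeval (betaGamma q)) |>.eq] at this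

/-- Both `B_0` and the sphere are invariant subalgebras, and invariance is reflected by the
injective map `of₀ q`; so gluing in `B` follows from gluing in `P`. -/
theorem mem_sphere_of_mem_B₀ (hq : q ≠ 0) {u : SOq3 q} (hu : of₀ q u ∈ B₀ q) : u ∈ sphere q := by
  rw [SOq3.sphere_eq_coinvariants hq]
  rw [(bundle₀ hq).base] at hu
  exact mem_coinvariants_of_map (intertwines_of₀ hq) (of₀_injective hq) hu

end QuantumBundle

end

open QuantumBundle
theorem proposition5p11 {k : Type*} [Field k] (q : k) (hq : q ≠ 0) :
    -- `P = SO_q(3)` is a quantum principal bundle over `B = S_q^2`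
    IsQuantumPrincipalBundle (SOq3.coaction q hq) (sphere q) ∧
    -- `P_0` over `B_0` and `P_1` over `B_1` are trivial bundles
    IsUnit (of₀ q (b3 q)) ∧
    IsTrivialBundle (coaction₀ hq) (B₀ q) (Φ₀ q).toLinearMap ∧
    IsUnit (of₁ q (1 - b3 q)) ∧
    IsTrivialBundle (coaction₁ hq) (B₁ q) (Φ₁ q).toLinearMap ∧
    -- the values `δ⁻¹α`, `α⁻¹δ`, `-γβ⁻¹`, `-βγ⁻¹` of the trivializations
    Φ₀ q (T 1) = ((unitαδ q)⁻¹ : (P₀ q)ˣ) * (unitαα q : P₀ q) ∧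
    Φ₀ q (T (-1)) = ((unitδα q)⁻¹ : (P₀ q)ˣ) * (unitδδ q : P₀ q) ∧
    Φ₁ q (T 1) = -((unitγβ q : P₁ q) * ((unitββ q)⁻¹ : (P₁ q)ˣ)) ∧
    Φ₁ q (T (-1)) = -((unitβγ q : P₁ q) * ((unitγγ q)⁻¹ : (P₁ q)ˣ)) ∧
    -- the restriction maps are injective and intertwine the coactions
    (Function.Injective (of₀ q) ∧
      Intertwines (SOq3.coaction q hq) (coaction₀ hq) (of₀ q)) ∧
    (Function.Injective (of₁ q) ∧
      Intertwines (SOq3.coaction q hq) (coaction₁ hq) (of₁ q)) ∧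
    (Function.Injective (res₀ q) ∧
      Intertwines (coaction₀ hq) (coaction₀₁ hq) (res₀ q)) ∧
    (Function.Injective (res₁ q) ∧
      Intertwines (coaction₁ hq) (coaction₀₁ hq) (res₁ q)) ∧
    (res₀ q).comp (of₀ q) = (res₁ q).comp (of₁ q) ∧
    -- elements over the two charts that agree over the double localization glue, in `P` and in `B`
    (∀ (u₀ : P₀ q) (u₁ : P₁ q), res₀ q u₀ = res₁ q u₁ →
      ∃! u : SOq3 q, of₀ q u = u₀ ∧ of₁ q u = u₁) ∧
    (∀ u₀ ∈ B₀ q, ∀ u₁ ∈ B₁ q, res₀ q u₀ = res₁ q u₁ →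
      ∃! u : SOq3 q, u ∈ sphere q ∧ of₀ q u = u₀ ∧ of₁ q u = u₁) ∧
    -- `P_01` over `B_01` is a trivial bundle, for each of the two restricted trivializations
    IsTrivialBundle (coaction₀₁ hq) (B₀₁ q) ((res₀ q).comp (Φ₀ q)).toLinearMap ∧
    IsTrivialBundle (coaction₀₁ hq) (B₀₁ q) ((res₁ q).comp (Φ₁ q)).toLinearMap ∧
    -- the two are related by the gauge transformation `γ_01`, with values in `B_01`
    ∃ γ : k[T;T⁻¹] →ₗ[k] B₀₁ q,
      γ 1 = 1 ∧
      IsUnit (WithConv.toConv γ) ∧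
      WithConv.toConv ((res₀ q).comp (Φ₀ q)).toLinearMap =
        WithConv.toConv ((B₀₁ q).val.toLinearMap ∘ₗ γ) *
          WithConv.toConv ((res₁ q).comp (Φ₁ q)).toLinearMap ∧
      ∀ n : ℤ, (γ (T n) : P₀₁ q) = res₀ q (Φ₀ q (T n)) * res₁ q (Φ₁ q (T (-n))) := by
  have hu₀ := transition₀_mem_weightSpace hq
  have hu₁ := transition₁_mem_weightSpace hq
  have hv₀ := (intertwines_res₀ hq).map_mem_weightSpace hu₀
  have hv₁ := (intertwines_res₁ hq).map_mem_weightSpace hu₁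
  have e₀ : (res₀ q).comp (Φ₀ q) = ofUnit (Units.map (res₀ q : P₀ q →* P₀₁ q) _) := comp_ofUnit _ _
  have e₁ : (res₁ q).comp (Φ₁ q) = ofUnit (Units.map (res₁ q : P₁ q →* P₀₁ q) _) := comp_ofUnit _ _
  refine ⟨bundle hq, isUnit_map_b3 fun _ => Loc.isUnit_of,
    ⟨bundle₀ hq, isTrivialization_ofUnit hu₀⟩, isUnit_map_one_sub_b3 hq fun _ => Loc.isUnit_of,
    ⟨bundle₁ hq, isTrivialization_ofUnit hu₁⟩, ?_, Φ₀_T_neg_one hq, ?_, Φ₁_T_neg_one,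
    ⟨of₀_injective hq, intertwines_of₀ hq⟩, ⟨of₁_injective hq, intertwines_of₁ hq⟩,
    ⟨res₀_injective hq, intertwines_res₀ hq⟩, ⟨res₁_injective hq, intertwines_res₁ hq⟩,
    res₀_comp_of₀.trans res₁_comp_of₁.symm, fun u₀ u₁ h => ?_, fun u₀ hu₀ u₁ _ h => ?_,
    ⟨bundle₀₁ hq, ?_⟩, ⟨bundle₀₁ hq, ?_⟩, ?_⟩
  · rw [Φ₀, ofUnit_T, zpow_one, Units.val_mul]
  · rw [Φ₁, ofUnit_T, zpow_one, Units.val_neg, Units.val_mul]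
  · obtain ⟨u, h₀, h₁⟩ := exists_glue_charts hq u₀ u₁ h
    exact ⟨u, ⟨h₀, h₁⟩, fun v hv => of₀_injective hq (hv.1.trans h₀.symm)⟩
  · obtain ⟨u, h₀, h₁⟩ := exists_glue_charts hq u₀ u₁ h
    exact ⟨u, ⟨mem_sphere_of_mem_B₀ hq (h₀ ▸ hu₀), h₀, h₁⟩,
      fun v hv => of₀_injective hq (hv.2.1.trans h₀.symm)⟩
  · rw [e₀]
    exact isTrivialization_ofUnit hv₀
  · rw [e₁]
    exact isTrivialization_ofUnit hv₁
  · simp only [← AlgHom.comp_apply]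
    rw [e₀, e₁]
    exact exists_gauge hv₀ hv₁ (bundle₀₁ hq).base
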